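/- Let $\mathbb{T}=\mathbb{R}/\mathbb{Z}$, let $k\ge 4$ be an integer, and let $F\colon\mathbb{T}^2\to[0,1]$ be Riemann integrable with constant first marginal $\alpha$, i.e. $\int_{\mathbb{T}}F(x,y)\,dy=\alpha$ for almost every $x\in\mathbb{T}$. For each positive integer $N$ define $f_N\colon\mathbb{Z}/N\mathbb{Z}\to[0,1]$ by \[ f_N(n)=F\bigl(n/N \bmod 1,\; n^{k-2}/N \bmod 1\bigr). \] For a finite abelian group $G$ and $g\colon G\to\mathbb{C}$ put $\partial_h g(n)=g(n)\overline{g(n-h)}$, define the Gowers norm by $\|g\|_{U^{d}(G)}^{2^{d}}=\mathbb{E}_{n,h_1,\dots,h_d\in G}\,\partial_{h_1}\cdots\partial_{h_d}g(n)$, and let $\Lambda_k(g)=\mathbb{E}_{n,d\in G}\,g(n)g(n+d)\cdots g(n+(k-1)d)$. Let $V\subset\mathbb{T}^{2k}$ be the closed subgroup of all $(x_1,\dots,x_k,y_1,\dots,y_k)$ with \[ x_2-x_1=\cdots=x_k-x_{k-1}\qquad\text{and}\qquad \sum_{i=0}^{k-1}(-1)^i\binom{k-1}{i}y_{i+1}=0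 . \] Then, as $N\to\infty$ over all positive integers, \[ \|f_N-\alpha\|_{U^{k-2}(\mathbb{Z}/N\mathbb{Z})}\to 0 . \] Moreover, the function $F(x_1,y_1)\cdots F(x_k,y_k)$ is integrable on $V$ with respect to the Haar probability measure of $V$, and \[ \Lambda_k(f_N)\to\widetilde\Lambda_k(F):=\mathbb{E}_{(x_1,\dots,x_k,y_1,\dots,y_k)\in V}F(x_1,y_1)\cdots F(x_k,y_k), \] the average being with respect to that measure. -/

import Mathlib

open MeasureTheory Filter Topology
open scoped BigOperators ComplexConjugate

/-- The half-open unit square as a box in `ℝ²` (its closure is `[0,1]²`). -/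
def unitSquareBox : BoxIntegral.Box (Fin 2) where
  lower := fun _ => 0
  upper := fun _ => 1
  lower_lt_upper := fun _ => zero_lt_one

/-- A function on the torus `𝕋² = (ℝ/ℤ)²` is Riemann integrable if its periodic lift to `ℝ²`
is Riemann integrable on the unit square (limit of Riemann sums over tagged partitions into boxes
as the mesh tends to zero). -/
def TorusRiemannIntegrable (F : UnitAddCircle × UnitAddCircle → ℝ) : Prop :=
  BoxIntegral.Integrable unitSquareBox BoxIntegral.IntegrationParams.Riemann
    (fun p : Fin 2 → ℝ => F ((p 0 : UnitAddCircle), (p 1 : UnitAddCircle)))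
    BoxIntegral.BoxAdditiveMap.volume

/-- `∫_𝕋 F(x, y) dy = α` for almost every `x`. -/
def HasConstantFirstMarginal (F : UnitAddCircle × UnitAddCircle → ℝ) (α : ℝ) : Prop :=
  ∀ᵐ x : UnitAddCircle, ∫ y : UnitAddCircle, F (x, y) = α

/-- `f_N(n) = F(n/N mod 1, n^(k-2)/N mod 1)` for `n ∈ ℤ/Nℤ`. Here `ZMod.toAddCircle` is the
homomorphism `j mod N ↦ j/N mod 1` from `ℤ/Nℤ` to `ℝ/ℤ`. -/
noncomputable def torusSample (k : ℕ) (F : UnitAddCircle × UnitAddCircle → ℝ) (N : ℕ) [NeZero N]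
    (n : ZMod N) : ℝ :=
  F (ZMod.toAddCircle n, ZMod.toAddCircle (n ^ (k - 2)))

section FiniteGroup

variable {G : Type*} [AddCommGroup G]

/-- The multiplicative derivative `∂_h f(n) = f(n) * conj (f(n - h))`. -/
noncomputable def mulDerivative (h : G) (f : G → ℂ) : G → ℂ :=
  fun n => f n * conj (f (n - h))

/-- `𝔼_{n, h₁, …, h_d} ∂_{h₁} ⋯ ∂_{h_d} f(n)`. -/
noncomputable def gowersAverage [Fintype G] (d : ℕ) (f : G → ℂ) : ℂ :=
  Finset.expect Finset.univ fun h : Fin d → G =>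
    Finset.expect Finset.univ fun n : G => (List.ofFn h).foldr mulDerivative f n

/-- The Gowers uniformity norm `‖f‖_{U^d}`, i.e. the `2^d`-th root of `gowersAverage d f` (which is
a nonnegative real number for `d ≥ 1`, hence equal to its modulus). -/
noncomputable def gowersNorm [Fintype G] (d : ℕ) (f : G → ℂ) : ℝ :=
  ‖gowersAverage d f‖ ^ (((2 : ℝ) ^ d)⁻¹)

/-- `Λ_k(f) = 𝔼_{n, d} f(n) f(n + d) ⋯ f(n + (k-1)d)`. -/
noncomputable def apDensity [Fintype G] (k : ℕ) (f : G → ℝ) : ℝ :=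
  Finset.expect Finset.univ fun n : G =>
    Finset.expect Finset.univ fun d : G => ∏ i : Fin k, f (n + (i : ℕ) • d)

end FiniteGroup

/-- The closed subgroup `V` of `𝕋^k × 𝕋^k` of all `(x₁, …, x_k, y₁, …, y_k)` (indexed from `0` here)
such that `x₂ - x₁ = ⋯ = x_k - x_{k-1}` and `∑_{i=0}^{k-1} (-1)^i (k-1 choose i) y_{i+1} = 0`. -/
def apBinomialSubgroup (k : ℕ) :
    AddSubgroup ((Fin k → UnitAddCircle) × (Fin k → UnitAddCircle)) where
  carrier := {p |
    (∀ i : ℕ, ∀ hi : i + 2 < k,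
      p.1 ⟨i + 1, by omega⟩ - p.1 ⟨i, by omega⟩ = p.1 ⟨i + 2, hi⟩ - p.1 ⟨i + 1, by omega⟩) ∧
    ∑ i : Fin k, ((-1 : ℤ) ^ (i : ℕ) * ((k - 1).choose (i : ℕ) : ℤ)) • p.2 i = 0}
  zero_mem' := by simp
  add_mem' := by
    rintro p q ⟨hp, hp'⟩ ⟨hq, hq'⟩
    refine ⟨fun i hi => ?_, ?_⟩
    · have h1 := hp i hi
      have h2 := hq i hi
      simp only [Prod.fst_add, Pi.add_apply, add_sub_add_comm, h1, h2]
    · simp only [Prod.snd_add, Pi.add_apply, smul_add, Finset.sum_add_distrib, hp', hq', add_zero]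
  neg_mem' := by
    rintro p ⟨hp, hp'⟩
    refine ⟨fun i hi => ?_, ?_⟩
    · have h1 := hp i hi
      simp only [Prod.fst_neg, Pi.neg_apply, neg_sub_neg]
      rw [← neg_sub, h1, neg_sub]
    · simp only [Prod.snd_neg, Pi.neg_apply, smul_neg, Finset.sum_neg_distrib, hp', neg_zero]

theorem isClosed_apBinomialSubgroup (k : ℕ) :
    IsClosed (apBinomialSubgroup k :
      Set ((Fin k → UnitAddCircle) × (Fin k → UnitAddCircle))) := by
  have h : (apBinomialSubgroup k : Set ((Fin k → UnitAddCircle) × (Fin k → UnitAddCircle))) =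
      {p | (∀ i : ℕ, ∀ hi : i + 2 < k,
        p.1 ⟨i + 1, by omega⟩ - p.1 ⟨i, by omega⟩ = p.1 ⟨i + 2, hi⟩ - p.1 ⟨i + 1, by omega⟩) ∧
      ∑ i : Fin k, ((-1 : ℤ) ^ (i : ℕ) * ((k - 1).choose (i : ℕ) : ℤ)) • p.2 i = 0} := rfl
  rw [h, Set.ofPred_and]
  refine IsClosed.inter ?_ ?_
  · simp only [Set.ofPred_forall]
    refine isClosed_iInter fun i => isClosed_iInter fun hi => ?_
    exact isClosed_eq (by fun_prop) (by fun_prop)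
  · refine isClosed_eq ?_ continuous_const
    fun_prop

instance compactSpace_apBinomialSubgroup (k : ℕ) : CompactSpace (apBinomialSubgroup k) :=
  isCompact_iff_compactSpace.mp (isClosed_apBinomialSubgroup k).isCompact

/-- The Haar measure of total mass `1` on the compact group `V`. -/
noncomputable def apBinomialMeasure (k : ℕ) : Measure (apBinomialSubgroup k) :=
  Measure.addHaarMeasure ⊤

/-- `F(x₁, y₁) ⋯ F(x_k, y_k)` as a function of the point `(x, y)` of `V`. -/
noncomputable def apBinomialProduct (k : ℕ) (F : UnitAddCircle × UnitAddCircle → ℝ)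
    (v : apBinomialSubgroup k) : ℝ :=
  ∏ i : Fin k, F (v.1.1 i, v.1.2 i)

/-- `Λ̃_k(F) = 𝔼_{(x, y) ∈ V} F(x₁, y₁) ⋯ F(x_k, y_k)`. -/
noncomputable def torusApDensity (k : ℕ) (F : UnitAddCircle × UnitAddCircle → ℝ) : ℝ :=
  ∫ v, apBinomialProduct k F v ∂(apBinomialMeasure k)

/-! Both limits are equidistribution statements. Write `k = j + 3`, so that the second coordinate of
the sample is the power of degree `j + 1 = k - 2`. Along a progression, the only asymptotic
relations between the values are that the first coordinates form a progression and that the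
`(k-1)`-st difference of the powers vanishes, so the sample points equidistribute in `V`. Along a
`(k-2)`-dimensional cube, the first coordinates form a free cube and the `2^(k-2)` powers become
independent. The limit of the Gowers average of `F - α` is then, by Fubini, an integral of products
of fibre integrals `∫ (F(x,y) - α) dy`, which vanish.

Equidistribution is tested on characters. A character trivial on the limit group is trivial at every
sample point. Any other gives a polynomial phase with integer coefficients independent of `N`. Van
der Corput differencing along suitable fixed directions reduces it to a linear phase whose increment
is a fixed nonzero integer `C`; its average is exactly `0` once `N > |C|`, for prime and composite
`N` alike (`tendsto_expect_polynomialPhase_zero`). The directions are chosen so that the product of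
the linear forms kills every top-degree term but one.

Trigonometric polynomials are dense in the continuous functions, and a Riemann integrable `F` lies
within `u` of a continuous `g` with `∫ u` small. Every coordinate of the limit object is uniform on
the 2-torus, so replacing `F` by `g` is cheap (`tendsto_expect_prod_of_characters`). -/

/-- The standard character `x ↦ exp (2πix)` of `ℝ/ℤ`. -/
noncomputable def unitChar (x : UnitAddCircle) : ℂ := AddCircle.toCircle x

theorem unitChar_zero : unitChar 0 = 1 := by simp [unitChar]

theorem unitChar_add (x y : UnitAddCircle) : unitChar (x + y) = unitChar x * unitChar y := by
  simp [unitChar, AddCircle.toCircle_add]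

theorem conj_unitChar (x : UnitAddCircle) : conj (unitChar x) = unitChar (-x) := by
  rw [unitChar, unitChar, AddCircle.toCircle_neg, Circle.coe_inv_eq_conj]

theorem norm_unitChar (x : UnitAddCircle) : ‖unitChar x‖ = 1 := Circle.norm_coe _

theorem unitChar_eq_one_iff {x : UnitAddCircle} : unitChar x = 1 ↔ x = 0 := by
  refine ⟨fun h => ?_, fun h => h ▸ unitChar_zero⟩
  apply AddCircle.injective_toCircle one_ne_zero
  rw [AddCircle.toCircle_zero]
  exact Circle.ext (by simpa [unitChar] using h)

theorem unitChar_sum {ι : Type*} (s : Finset ι) (x : ι → UnitAddCircle) :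
    unitChar (∑ i ∈ s, x i) = ∏ i ∈ s, unitChar (x i) := by
  classical
  induction s using Finset.induction_on with
  | empty => simp [unitChar_zero]
  | insert a s ha ih => rw [Finset.sum_insert ha, Finset.prod_insert ha, unitChar_add, ih]

/-! ### Van der Corput differencing on finite abelian groups -/

theorem expect_add_right {G M : Type*} [AddCommGroup G] [Fintype G] [AddCommMonoid M]
    [Module ℚ≥0 M] (f : G → M) (v : G) : (𝔼 x, f (x + v)) = 𝔼 x, f x :=
  Fintype.expect_equiv (Equiv.addRight v) _ _ fun _ => rfl

/-- The van der Corput inequality on a finite abelian group, with shifts along multiples of `v`. -/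
theorem norm_expect_sq_le_of_shifts {G : Type*} [AddCommGroup G] [Fintype G] (f : G → ℂ)
    (hf : ∀ x, ‖f x‖ ≤ 1) (v : G) {H : ℕ} (hH : 0 < H) :
    ‖𝔼 x, f x‖ ^ 2 ≤ (1 / (H : ℝ) ^ 2) * ∑ s ∈ Finset.range H, ∑ t ∈ Finset.range H,
      if s = t then 1 else ‖𝔼 x, f (x + s • v) * conj (f (x + t • v))‖ := by
  have hH' : (H : ℂ) ≠ 0 := by exact_mod_cast hH.ne'
  -- Summing over `H` shifts multiplies the mean by `H`. After Cauchy–Schwarz, expanding `|S|²`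
  -- yields the correlations of pairs of shifts.
  set S : G → ℂ := fun x => ∑ s ∈ Finset.range H, f (x + s • v) with hS
  have h1 : (𝔼 x, S x) = H * 𝔼 x, f x := by
    simp only [hS]
    rw [Finset.expect_sum_comm]
    simp [expect_add_right f]
  have h2 : ‖𝔼 x, S x‖ ^ 2 ≤ 𝔼 x, ‖S x‖ ^ 2 := by
    have h := Finset.expect_mul_sq_le_sq_mul_sq (Finset.univ : Finset G) (fun x => ‖S x‖)
      (fun _ => (1 : ℝ))
    simp only [mul_one, one_pow, Fintype.expect_const] at h
    refine le_trans ?_ h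
    gcongr
    exact RCLike.norm_expect_le (K := ℂ)
  have h3 : (((𝔼 x, ‖S x‖ ^ 2 : ℝ)) : ℂ) =
      ∑ s ∈ Finset.range H, ∑ t ∈ Finset.range H, 𝔼 x, f (x + s • v) * conj (f (x + t • v)) := by
    have h4 : ∀ x, ((‖S x‖ ^ 2 : ℝ) : ℂ) = ∑ s ∈ Finset.range H, ∑ t ∈ Finset.range H,
        f (x + s • v) * conj (f (x + t • v)) := by
      intro x
      rw [Complex.ofReal_pow, ← Complex.mul_conj', hS, map_sum, Finset.sum_mul_sum]
    rw [Complex.ofReal_expect]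
    simp only [h4, Finset.expect_sum_comm]
  have h5 : (𝔼 x, ‖S x‖ ^ 2) ≤ ∑ s ∈ Finset.range H, ∑ t ∈ Finset.range H,
      if s = t then 1 else ‖𝔼 x, f (x + s • v) * conj (f (x + t • v))‖ := by
    have h6 : (𝔼 x, ‖S x‖ ^ 2) = ‖(((𝔼 x, ‖S x‖ ^ 2 : ℝ)) : ℂ)‖ := by
      rw [Complex.norm_real, Real.norm_of_nonneg (Finset.expect_nonneg fun _ _ => by positivity)]
    rw [h6, h3]
    refine (norm_sum_le _ _).trans (Finset.sum_le_sum fun s _ => (norm_sum_le _ _).trans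
      (Finset.sum_le_sum fun t _ => ?_))
    split_ifs with hst
    · refine (RCLike.norm_expect_le (K := ℂ)).trans (Finset.expect_le Finset.univ_nonempty
        fun x _ => ?_)
      rw [norm_mul, RCLike.norm_conj]
      exact mul_le_one₀ (hf _) (norm_nonneg _) (hf _)
    · exact le_rfl
  have h7 : ‖𝔼 x, f x‖ ^ 2 = 1 / (H : ℝ) ^ 2 * ‖𝔼 x, S x‖ ^ 2 := by
    rw [h1, norm_mul, Complex.norm_natCast]
    field_simp
  rw [h7]
  gcongr
  exact h2.trans h5

/-- For fixed `H` the off-diagonal correlations die in the limit, and the diagonal contributes `H /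
H² = 1 / H`, which is below any `ε` for `H` large. -/
theorem tendsto_expect_zero_of_shifts {ι : Type*} {l : Filter ι} (G : ι → Type*)
    [∀ N, AddCommGroup (G N)] [∀ N, Fintype (G N)] (f : ∀ N, G N → ℂ) (hf : ∀ N x, ‖f N x‖ ≤ 1)
    (v : ∀ N, G N)
    (h : ∀ s t : ℕ, s ≠ t → Tendsto (fun N => 𝔼 x, f N (x + s • v N) * conj (f N (x + t • v N))) l
      (𝓝 0)) :
    Tendsto (fun N => 𝔼 x, f N x) l (𝓝 0) := by
  have key : Tendsto (fun N => ‖𝔼 x, f N x‖ ^ 2) l (𝓝 0) := by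
    rw [Metric.tendsto_nhds]
    intro ε hε
    obtain ⟨H, hH⟩ := exists_nat_gt (1 / ε)
    have hH0 : 0 < (H : ℝ) := (by positivity : 0 < 1 / ε).trans hH
    have hlim : Tendsto (fun N => (1 / (H : ℝ) ^ 2) * ∑ s ∈ Finset.range H, ∑ t ∈ Finset.range H,
        if s = t then 1 else ‖𝔼 x, f N (x + s • v N) * conj (f N (x + t • v N))‖) l
        (𝓝 ((1 / (H : ℝ) ^ 2) * ∑ s ∈ Finset.range H, ∑ t ∈ Finset.range H,
          if s = t then 1 else 0)) := by
      refine Tendsto.const_mul _ (tendsto_finsetSum _ fun s _ => tendsto_finsetSum _ fun t _ => ?_)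
      split_ifs with hst
      · exact tendsto_const_nhds
      · simpa using (h s t hst).norm
    have hval : (1 / (H : ℝ) ^ 2) * ∑ s ∈ Finset.range H, ∑ t ∈ Finset.range H,
        (if s = t then (1 : ℝ) else 0) = 1 / H := by
      have : ∑ s ∈ Finset.range H, ∑ t ∈ Finset.range H, (if s = t then (1 : ℝ) else 0) = H := by
        simp +contextual [Finset.sum_ite_eq]
      rw [this]
      field_simp
    rw [hval] at hlim
    have hlt : 1 / (H : ℝ) < ε := by
      rw [div_lt_iff₀ hH0]
      rwa [div_lt_iff₀ hε, mul_comm] at hH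
    filter_upwards [hlim.eventually_lt_const hlt] with N hN
    rw [Real.dist_eq, sub_zero, abs_of_nonneg (by positivity)]
    exact (norm_expect_sq_le_of_shifts (f N) (hf N) (v N) (by exact_mod_cast hH0)).trans_lt hN
  rw [tendsto_zero_iff_norm_tendsto_zero]
  simpa using key.sqrt

/-! ### Weyl's theorem for fixed integral polynomial phases modulo `N` -/

section Weyl

open Polynomial

theorem coeff_taylor_of_le {p : ℤ[X]} {n : ℕ} (hp : p.natDegree ≤ n) (a : ℤ) :
    (taylor a p).coeff n = p.coeff n := by
  rw [taylor_coeff, eval_eq_sum_range' (n := 1)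
    ((natDegree_hasseDeriv_le p n).trans_lt (by omega))]
  simp [hasseDeriv_coeff]

theorem coeff_taylor_of_le_add_one {p : ℤ[X]} {n : ℕ} (hp : p.natDegree ≤ n + 1) (a : ℤ) :
    (taylor a p).coeff n = p.coeff n + (n + 1) * p.coeff (n + 1) * a := by
  rw [taylor_coeff, eval_eq_sum_range' (n := 2)
    ((natDegree_hasseDeriv_le p n).trans_lt (by omega))]
  simp [hasseDeriv_coeff, Finset.sum_range_succ, add_comm 1 n]

/-- The top coefficient does not change under translation, so it cancels: differencing lowers the
degree. -/
theorem natDegree_taylor_sub_taylor_le {p : ℤ[X]} {n : ℕ} (hp : p.natDegree ≤ n + 1) (a b : ℤ) :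
    (taylor a p - taylor b p).natDegree ≤ n := by
  rw [natDegree_le_iff_coeff_eq_zero]
  intro m hm
  rw [coeff_sub, coeff_taylor_of_le (by omega), coeff_taylor_of_le (by omega), sub_self]

/-- Weyl's theorem in several variables over `ℤ/Nℤ`: a fixed integral polynomial phase of degree
at most `j + 1`, whose derivative along some `j + 1` fixed directions is a nonzero constant,
has averages tending to `0`. -/
theorem tendsto_expect_polynomialPhase_zero {I : Type*} [Fintype I] (G : ℕ+ → Type*)
    [∀ N, AddCommGroup (G N)] [∀ N, Fintype (G N)] (L : ∀ N : ℕ+, I → G N →+ ZMod N) (j : ℕ)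
    (v : Fin (j + 1) → ∀ N, G N) (c : Fin (j + 1) → I → ℤ)
    (hL : ∀ N l i, L N i (v l N) = c l i) (p : I → ℤ[X])
    (hp : ∀ i, (p i).natDegree ≤ j + 1)
    (hne : ∑ i, (p i).coeff (j + 1) * ∏ l, c l i ≠ 0) :
    Tendsto (fun N : ℕ+ => 𝔼 x : G N,
      unitChar (ZMod.toAddCircle (∑ i, aeval (L N i x) (p i)))) atTop (𝓝 0) := by
  induction j generalizing p with
  | zero =>
    set C : ℤ := ∑ i, (p i).coeff 1 * c 0 i with hC
    have hC0 : C ≠ 0 := by simpa [hC] using hne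
    refine tendsto_const_nhds.congr' ?_
    -- Once `N > |C|`, the fixed nonzero integer `C` is nonzero modulo `N`, whatever the
    -- factorisation of `N`.
    filter_upwards [eventually_ge_atTop (⟨C.natAbs + 1, Nat.succ_pos _⟩ : ℕ+)] with N hN
    have hN' : C.natAbs < (N : ℕ) := hN
    have hCN : (C : ZMod N) ≠ 0 := by
      rw [Ne, ZMod.intCast_zmod_eq_zero_iff_dvd]
      intro hdvd
      exact absurd (Int.natAbs_dvd_natAbs.2 hdvd) (fun h => by
        have := Nat.le_of_dvd (Int.natAbs_pos.2 hC0) h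
        simp at this
        omega)
    set f : G N → ℂ := fun x => unitChar (ZMod.toAddCircle (∑ i, aeval (L N i x) (p i)))
    have hlin : ∀ i (y : ZMod N), aeval y (p i) = (p i).coeff 0 + (p i).coeff 1 * y := by
      intro i y
      rw [aeval_eq_sum_range' (n := 2) ((hp i).trans_lt (by omega))]
      simp [Finset.sum_range_succ]
    -- By translation invariance the average equals itself times a number other than `1`, hence is
    -- exactly `0`.
    have hshift : ∀ x, f (x + v 0 N) = f x * unitChar (ZMod.toAddCircle (C : ZMod N)) := by
      intro x
      simp only [f]
      rw [← unitChar_add, ← map_add]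
      congr 2
      simp only [hlin, map_add, hL, hC, Int.cast_sum, Int.cast_mul, ← Finset.sum_add_distrib]
      exact Finset.sum_congr rfl fun i _ => by ring
    have h1 := expect_add_right f (v 0 N)
    simp only [hshift, ← Finset.expect_mul] at h1
    have h2 : unitChar (ZMod.toAddCircle (C : ZMod N)) ≠ 1 := by
      rw [Ne, unitChar_eq_one_iff, ZMod.toAddCircle_eq_zero]
      exact hCN
    by_contra h3
    exact h2 (mul_left_cancel₀ (Ne.symm h3) (h1.trans (mul_one _).symm))
  | succ j ih =>
    refine tendsto_expect_zero_of_shifts G _ (fun N x => (norm_unitChar _).le) (v 0) ?_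
    intro s t hst
    set q : I → ℤ[X] := fun i => taylor (s * c 0 i) (p i) - taylor (t * c 0 i) (p i) with hq
    have h := ih (fun l => v l.succ) (fun l => c l.succ) (fun N l i => hL N _ i) q
      (fun i => natDegree_taylor_sub_taylor_le (hp i) _ _) ?_
    · refine h.congr fun N => Finset.expect_congr rfl fun x _ => ?_
      rw [conj_unitChar, ← unitChar_add, ← map_neg, ← map_add, ← sub_eq_add_neg,
        ← Finset.sum_sub_distrib]
      congr 2
      refine Finset.sum_congr rfl fun i _ => ?_
      have haev : ∀ (a : ℤ) (y : ZMod N), aeval y (taylor a (p i)) = aeval (y + a) (p i) := by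
        intro a y
        simp [taylor_apply, aeval_comp]
      simp [hq, haev, hL]
    -- Differencing consumes the direction `v 0`: the invariant of the remaining directions is the
    -- old one times `(j + 2)(s - t)`, which is nonzero off the diagonal.
    · have : ∑ i, (q i).coeff (j + 1) * ∏ l : Fin (j + 1), c l.succ i =
          ((j + 2 : ℕ) * ((s : ℤ) - t)) * ∑ i, (p i).coeff (j + 1 + 1) * ∏ l, c l i := by
        rw [Finset.mul_sum]
        refine Finset.sum_congr rfl fun i _ => ?_
        rw [hq, Fin.prod_univ_succ (fun l => c l i), coeff_sub, coeff_taylor_of_le_add_one (hp i),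
          coeff_taylor_of_le_add_one (hp i)]
        push_cast
        ring
      rw [this]
      refine mul_ne_zero (mul_ne_zero (by positivity) ?_) hne
      rw [sub_ne_zero]
      exact_mod_cast hst

end Weyl

/-! ### Weyl's criterion on tori -/

theorem mFourier_eq_unitChar {d : Type*} [Fintype d] (m : d → ℤ) (z : UnitAddTorus d) :
    UnitAddTorus.mFourier m z = unitChar (∑ i, m i • z i) := by
  rw [unitChar_sum]
  simp [UnitAddTorus.mFourier, fourier_apply, unitChar]

/-- Weyl's criterion: convergence of the averages of all characters of a torus implies convergence
of the averages of all continuous functions. -/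
theorem tendsto_expect_continuousMap_of_characters {d : Type*} [Fintype d] {ι : Type*}
    {l : Filter ι} (S : ι → Type*) [∀ N, Fintype (S N)] [∀ N, Nonempty (S N)]
    (P : ∀ N, S N → UnitAddTorus d) {W : Type*} [MeasurableSpace W] (ν : Measure W)
    [IsProbabilityMeasure ν] (Q : W → UnitAddTorus d) (hQ : Measurable Q)
    (h : ∀ m : d → ℤ, Tendsto (fun N => 𝔼 s, unitChar (∑ i, m i • P N s i)) l
      (𝓝 (∫ w, unitChar (∑ i, m i • Q w i) ∂ν))) (φ : C(UnitAddTorus d, ℂ)) :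
    Tendsto (fun N => 𝔼 s, φ (P N s)) l (𝓝 (∫ w, φ (Q w) ∂ν)) := by
  have hint : ∀ ψ : C(UnitAddTorus d, ℂ), Integrable (fun w => ψ (Q w)) ν := fun ψ =>
    Integrable.of_bound (ψ.continuous.measurable.comp hQ).aestronglyMeasurable ‖ψ‖
      (ae_of_all _ fun w => ψ.norm_coe_le_norm _)
  have hspan : ∀ ψ ∈ Submodule.span ℂ (Set.range <| UnitAddTorus.mFourier (d := d)),
      Tendsto (fun N => 𝔼 s, ψ (P N s)) l (𝓝 (∫ w, ψ (Q w) ∂ν)) := by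
    intro ψ hψ
    induction hψ using Submodule.span_induction with
    | mem x hx =>
      obtain ⟨m, rfl⟩ := hx
      simpa only [mFourier_eq_unitChar] using h m
    | zero => simpa using tendsto_const_nhds
    | add f g _ _ hf hg =>
      simp only [ContinuousMap.add_apply, Finset.expect_add_distrib]
      rw [integral_add (hint f) (hint g)]
      exact hf.add hg
    | smul a f _ hf =>
      simp only [ContinuousMap.smul_apply, smul_eq_mul, ← Finset.mul_expect, integral_const_mul]
      exact hf.const_mul a
  rw [Metric.tendsto_nhds]
  intro ε hε
  have hmem : φ ∈ (Submodule.span ℂ (Set.range <| UnitAddTorus.mFourier (d := d))).topologicalClosure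
      := by
    rw [UnitAddTorus.span_mFourier_closure_eq_top]
    trivial
  obtain ⟨ψ, hψ, hφψ⟩ := Metric.mem_closure_iff.1 hmem (ε / 3) (by positivity)
  have hpt : ∀ z, ‖φ z - ψ z‖ ≤ ε / 3 := fun z => by
    rw [← dist_eq_norm]
    exact (ContinuousMap.dist_apply_le_dist z).trans hφψ.le
  filter_upwards [Metric.tendsto_nhds.1 (hspan ψ hψ) (ε / 3) (by positivity)] with N hN
  have h1 : dist (𝔼 s, φ (P N s)) (𝔼 s, ψ (P N s)) ≤ ε / 3 := by
    rw [dist_eq_norm, ← Finset.expect_sub_distrib]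
    exact (RCLike.norm_expect_le (K := ℂ)).trans
      (Finset.expect_le Finset.univ_nonempty fun s _ => hpt _)
  have h2 : dist (∫ w, ψ (Q w) ∂ν) (∫ w, φ (Q w) ∂ν) ≤ ε / 3 := by
    rw [dist_comm, dist_eq_norm, ← integral_sub (hint φ) (hint ψ)]
    refine (norm_integral_le_of_norm_le_const (ae_of_all _ fun w => hpt (Q w))).trans ?_
    simp
  calc dist (𝔼 s, φ (P N s)) (∫ w, φ (Q w) ∂ν)
      ≤ dist (𝔼 s, φ (P N s)) (𝔼 s, ψ (P N s)) + dist (𝔼 s, ψ (P N s)) (∫ w, ψ (Q w) ∂ν)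
        + dist (∫ w, ψ (Q w) ∂ν) (∫ w, φ (Q w) ∂ν) := dist_triangle4 _ _ _ _
    _ < ε := by linarith

/-! ### Passage from characters to Riemann integrable functions -/

/-- `F` is squeezed, up to arbitrarily small integral, between continuous functions `g ± u`. -/
def HasContinuousSqueeze (F : UnitAddCircle × UnitAddCircle → ℝ) : Prop :=
  ∀ ε > 0, ∃ g u : C(UnitAddCircle × UnitAddCircle, ℝ),
    (∀ p, |g p| ≤ 1) ∧ (∀ p, |F p - g p| ≤ u p) ∧ ∫ p, u p ≤ ε

theorem integrable_continuousMap {X : Type*} [TopologicalSpace X] [CompactSpace X]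
    [MeasurableSpace X] [BorelSpace X] (μ : Measure X) [IsFiniteMeasure μ] (g : C(X, ℝ)) :
    Integrable g μ :=
  Integrable.of_bound g.continuous.measurable.aestronglyMeasurable ‖g‖
    (ae_of_all _ fun _ => g.norm_coe_le_norm _)

/-- Since `|F - g| ≤ u` with `u → 0` in `L¹`, the continuous functions `g` converge to `F` in
measure. No measurability of `F` is needed beforehand. -/
theorem HasContinuousSqueeze.aestronglyMeasurable {F : UnitAddCircle × UnitAddCircle → ℝ}
    (hF : HasContinuousSqueeze F) : AEStronglyMeasurable F volume := by
  choose g u hg hFg hu using fun n : ℕ => hF (1 / ((n : ℝ) + 1)) (by positivity)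
  have hu0 : ∀ n p, 0 ≤ u n p := fun n p => (abs_nonneg _).trans (hFg n p)
  have h1 : TendstoInMeasure volume (fun n p => u n p) atTop (fun _ => (0 : ℝ)) := by
    refine tendstoInMeasure_of_tendsto_eLpNorm one_ne_zero
      (fun n => (u n).continuous.measurable.aestronglyMeasurable)
      aestronglyMeasurable_const ?_
    have h2 : ∀ n, eLpNorm ((fun p => u n p) - fun _ => (0 : ℝ)) 1 volume
        = ENNReal.ofReal (∫ p, u n p) := by
      intro n
      rw [eLpNorm_one_eq_lintegral_enorm,
        ofReal_integral_eq_lintegral_ofReal (integrable_continuousMap _ _) (ae_of_all _ (hu0 n))]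
      refine lintegral_congr fun p => ?_
      simp [Real.enorm_of_nonneg (hu0 n p)]
    simp only [h2]
    rw [← ENNReal.ofReal_zero]
    refine ENNReal.tendsto_ofReal (squeeze_zero (fun n => integral_nonneg (hu0 n)) hu ?_)
    exact tendsto_one_div_add_atTop_nhds_zero_nat
  have h3 : TendstoInMeasure volume (fun n p => g n p) atTop F := by
    intro ε hε
    refine tendsto_of_tendsto_of_tendsto_of_le_of_le tendsto_const_nhds (h1 ε hε)
      (fun _ => zero_le) fun n => measure_mono fun p hp => ?_
    simp only [Set.mem_ofPred_eq, edist_dist] at hp ⊢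
    refine hp.trans (ENNReal.ofReal_le_ofReal ?_)
    rw [dist_comm, Real.dist_eq, Real.dist_eq, sub_zero, abs_of_nonneg (hu0 n p)]
    exact hFg n p
  exact h3.aestronglyMeasurable fun n => (g n).continuous.measurable.aestronglyMeasurable

/-- Telescoping: the factors are exchanged one at a time. -/
theorem abs_prod_sub_prod_le_sum {I : Type*} (s : Finset I) (a b : I → ℝ) (ha : ∀ i, |a i| ≤ 1)
    (hb : ∀ i, |b i| ≤ 1) : |∏ i ∈ s, a i - ∏ i ∈ s, b i| ≤ ∑ i ∈ s, |a i - b i| := by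
  classical
  induction s using Finset.induction_on with
  | empty => simp
  | insert i s hi ih =>
    rw [Finset.prod_insert hi, Finset.prod_insert hi, Finset.sum_insert hi]
    have h1 : |∏ i ∈ s, b i| ≤ 1 := by
      rw [Finset.abs_prod]
      exact Finset.prod_le_one (fun _ _ => abs_nonneg _) fun i _ => hb i
    calc |a i * ∏ i ∈ s, a i - b i * ∏ i ∈ s, b i|
        = |(a i - b i) * ∏ i ∈ s, b i + a i * (∏ i ∈ s, a i - ∏ i ∈ s, b i)| := by ring_nf
      _ ≤ |a i - b i| * |∏ i ∈ s, b i| + |a i| * |∏ i ∈ s, a i - ∏ i ∈ s, b i| := by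
        rw [← abs_mul, ← abs_mul]
        exact abs_add_le _ _
      _ ≤ |a i - b i| * 1 + 1 * |∏ i ∈ s, a i - ∏ i ∈ s, b i| := by
        gcongr
        exact ha i
      _ ≤ _ := by linarith

section Transfer

variable {I W : Type*} [Fintype I] [MeasurableSpace W] {ν : Measure W} [IsProbabilityMeasure ν]
  {Q : W → I → UnitAddCircle × UnitAddCircle} {F : UnitAddCircle × UnitAddCircle → ℝ}

theorem integrable_prod_comp (hQ : ∀ i, MeasurePreserving (fun w => Q w i) ν volume)
    (hF1 : ∀ p, |F p| ≤ 1) (hF : AEStronglyMeasurable F volume) :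
    Integrable (fun w => ∏ i, F (Q w i)) ν := by
  refine Integrable.of_bound (Finset.aestronglyMeasurable_fun_prod _ fun i _ =>
    hF.comp_measurePreserving (hQ i)) 1 (ae_of_all _ fun w => ?_)
  rw [norm_prod]
  exact Finset.prod_le_one (fun _ _ => norm_nonneg _) fun i _ => hF1 _

/-- If finitely many sequences of points of `𝕋²` are jointly equidistributed in the limit object
`Q`, each of whose components is uniform, then averages of products of a Riemann integrable
function converge. -/
theorem tendsto_expect_prod_of_characters {ι : Type*} {l : Filter ι} (S : ι → Type*)
    [∀ N, Fintype (S N)] [∀ N, Nonempty (S N)] (P : ∀ N, S N → I → UnitAddCircle × UnitAddCircle)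
    (hQ : ∀ i, MeasurePreserving (fun w => Q w i) ν volume)
    (h : ∀ a b : I → ℤ, Tendsto
      (fun N => 𝔼 s, unitChar (∑ i, (a i • (P N s i).1 + b i • (P N s i).2))) l
      (𝓝 (∫ w, unitChar (∑ i, (a i • (Q w i).1 + b i • (Q w i).2)) ∂ν)))
    (hF1 : ∀ p, |F p| ≤ 1) (hF : HasContinuousSqueeze F) :
    Tendsto (fun N => 𝔼 s, ∏ i, F (P N s i)) l (𝓝 (∫ w, ∏ i, F (Q w i) ∂ν)) := by
  -- The two coordinates of each of the `I` points are listed separately, so that Weyl's criterion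
  -- on the torus indexed by `I ⊕ I` applies.
  let toTorus : (I → UnitAddCircle × UnitAddCircle) → UnitAddTorus (I ⊕ I) :=
    fun z => Sum.elim (fun i => (z i).1) (fun i => (z i).2)
  have hQm : Measurable fun w => toTorus (Q w) := by
    refine measurable_pi_lambda _ fun j => ?_
    cases j with
    | inl i => exact (hQ i).measurable.fst
    | inr i => exact (hQ i).measurable.snd
  have hcont : ∀ φ : C(I → UnitAddCircle × UnitAddCircle, ℝ),
      Tendsto (fun N => 𝔼 s, φ (P N s)) l (𝓝 (∫ w, φ (Q w) ∂ν)) := by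
    intro φ
    have h1 := tendsto_expect_continuousMap_of_characters S (fun N s => toTorus (P N s)) ν
      (fun w => toTorus (Q w)) hQm (l := l) ?_
      ⟨fun z => (φ fun i => (z (Sum.inl i), z (Sum.inr i)) : ℂ), by fun_prop⟩
    · simp only [toTorus, ContinuousMap.coe_mk, Sum.elim_inl, Sum.elim_inr, Prod.mk.eta,
        ← Complex.ofReal_expect, integral_complex_ofReal] at h1
      exact tendsto_ofReal_iff.1 h1
    · intro m
      have h2 := h (fun i => m (Sum.inl i)) (fun i => m (Sum.inr i))
      simpa [toTorus, Finset.sum_add_distrib] using h2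
  rw [Metric.tendsto_nhds]
  intro ε hε
  set c : ℝ := ((Fintype.card I : ℕ) : ℝ) with hc
  -- Each of the `c` coordinates costs `∫ u`, because it is uniform; the total stays below `ε / 4`.
  -- The `+ 1` covers an empty `I`.
  obtain ⟨g, u, hg, hFg, hu⟩ := hF (ε / (4 * (c + 1))) (by positivity)
  have hptwise : ∀ z : I → UnitAddCircle × UnitAddCircle,
      |∏ i, F (z i) - ∏ i, g (z i)| ≤ ∑ i, u (z i) := fun z =>
    (abs_prod_sub_prod_le_sum _ _ _ (fun i => hF1 _) fun i => hg _).trans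
      (Finset.sum_le_sum fun i _ => hFg _)
  have hintg : Integrable (fun w => ∏ i, g (Q w i)) ν :=
    integrable_prod_comp hQ hg g.continuous.measurable.aestronglyMeasurable
  have hintF : Integrable (fun w => ∏ i, F (Q w i)) ν :=
    integrable_prod_comp hQ hF1 hF.aestronglyMeasurable
  have hintu : ∀ i, Integrable (fun w => u (Q w i)) ν := fun i =>
    (hQ i).integrable_comp_of_integrable (integrable_continuousMap _ u)
  have hsum : ∫ w, ∑ i, u (Q w i) ∂ν ≤ ε / 4 := by
    rw [integral_finsetSum _ fun i _ => hintu i]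
    have : ∀ i, ∫ w, u (Q w i) ∂ν = ∫ p, u p := fun i => by
      rw [← (hQ i).map_eq, integral_map (hQ i).measurable.aemeasurable
        u.continuous.measurable.aestronglyMeasurable]
    simp only [this, Finset.sum_const, Finset.card_univ, nsmul_eq_mul]
    calc c * ∫ p, u p ≤ c * (ε / (4 * (c + 1))) := by gcongr
      _ = (c / (c + 1)) * (ε / 4) := by field_simp
      _ ≤ 1 * (ε / 4) := by
        gcongr
        rw [div_le_one (by positivity)]
        linarith
      _ = ε / 4 := one_mul _
  have hg' := hcont ⟨fun z => ∏ i, g (z i), by fun_prop⟩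
  have hu' := hcont ⟨fun z => ∑ i, u (z i), by fun_prop⟩
  simp only [ContinuousMap.coe_mk] at hg' hu'
  filter_upwards [Metric.tendsto_nhds.1 hg' (ε / 4) (by positivity),
    hu'.eventually_lt_const (hsum.trans_lt (by linarith : ε / 4 < ε / 2))] with N hN1 hN2
  have h1 : dist (𝔼 s, ∏ i, F (P N s i)) (𝔼 s, ∏ i, g (P N s i)) < ε / 2 := by
    rw [Real.dist_eq, ← Finset.expect_sub_distrib]
    exact ((Finset.abs_expect_le _ _).trans
      (Finset.expect_le_expect fun s _ => hptwise _)).trans_lt hN2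
  have h2 : dist (∫ w, ∏ i, g (Q w i) ∂ν) (∫ w, ∏ i, F (Q w i) ∂ν) ≤ ε / 4 := by
    rw [dist_comm, Real.dist_eq, ← integral_sub hintF hintg]
    refine (abs_integral_le_integral_abs).trans (le_trans ?_ hsum)
    exact integral_mono (hintF.sub hintg).abs (integrable_finsetSum _ fun i _ => hintu i)
      fun w => hptwise _
  calc dist (𝔼 s, ∏ i, F (P N s i)) (∫ w, ∏ i, F (Q w i) ∂ν) ≤ _ := dist_triangle4 _ _ _ _
    _ < ε / 2 + ε / 4 + ε / 4 := add_lt_add_of_lt_of_le (add_lt_add h1 hN1) h2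
    _ = ε := by ring

end Transfer

/-! ### Darboux's criterion from Riemann sums over grids -/

section Darboux

open BoxIntegral BoxIntegral.unitPartition

/-- The partition of the unit square into squares of side `1 / m`, with prescribed tags. -/
noncomputable def gridPartition (m : ℕ) [NeZero m] (X : (Fin 2 → ℤ) → Fin 2 → ℝ)
    (hX : ∀ ν, X ν ∈ Box.Icc (box m ν)) : TaggedPrepartition unitSquareBox :=
  open scoped Classical in
  { (prepartition m unitSquareBox).toPrepartition with
    -- The upper vertex of a grid box determines its index. Tags must be defined for all boxes, so
    -- those outside the partition get an arbitrary point of the square.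
    tag := fun J => if J ∈ (prepartition m unitSquareBox).boxes then X (index m J.upper)
      else unitSquareBox.upper
    tag_mem_Icc := by
      intro J
      split_ifs with hJ
      · obtain ⟨ν, hν, rfl⟩ := mem_prepartition_boxes_iff.1 hJ
        have h : index m (box m ν).upper = ν := index_tag m ν
        rw [h]
        exact Box.le_iff_Icc.1 (mem_admissibleIndex_iff.1 hν) (hX ν)
      · exact unitSquareBox.upper_mem_Icc }

theorem gridPartition_tag {m : ℕ} [NeZero m] {X : (Fin 2 → ℤ) → Fin 2 → ℝ}
    (hX : ∀ ν, X ν ∈ Box.Icc (box m ν)) {ν : Fin 2 → ℤ} (hν : ν ∈ admissibleIndex m unitSquareBox) :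
    (gridPartition m X hX).tag (box m ν) = X ν := by
  have h : index m (box m ν).upper = ν := index_tag m ν
  simp only [gridPartition, if_pos (mem_prepartition_boxes_iff.2 ⟨ν, hν, rfl⟩), h]

theorem integralSum_gridPartition (f : (Fin 2 → ℝ) → ℝ) {m : ℕ} [NeZero m]
    {X : (Fin 2 → ℤ) → Fin 2 → ℝ} (hX : ∀ ν, X ν ∈ Box.Icc (box m ν)) :
    integralSum f BoxAdditiveMap.volume (gridPartition m X hX) =
      ∑ ν ∈ admissibleIndex m unitSquareBox, f (X ν) / (m : ℝ) ^ 2 := by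
  classical
  have hb : (gridPartition m X hX).boxes =
      (admissibleIndex m unitSquareBox).image (fun ν => box m ν) := by
    ext J
    exact mem_prepartition_boxes_iff.trans (by simp)
  rw [integralSum, hb, Finset.sum_image fun x _ y _ h => box_injective m h]
  refine Finset.sum_congr rfl fun ν hν => ?_
  rw [gridPartition_tag hX hν, BoxAdditiveMap.volume_apply]
  simp only [box.upper_sub_lower, Finset.prod_const, Finset.card_univ, Fintype.card_fin,
    smul_eq_mul]
  field_simp

theorem unitSquareBox_hasIntegralVertices : hasIntegralVertices unitSquareBox :=
  ⟨fun _ => 0, fun _ => 1, fun _ => by simp [unitSquareBox], fun _ => by simp [unitSquareBox]⟩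

/-- For a fine grid, the Riemann sums with tags `X` and with tags `Y` are both within `ε / 2` of the
integral. -/
theorem gridSum_sub_le_of_riemannIntegrable {f : (Fin 2 → ℝ) → ℝ}
    (hf : BoxIntegral.Integrable unitSquareBox IntegrationParams.Riemann f BoxAdditiveMap.volume)
    {ε : ℝ} (hε : 0 < ε) :
    ∃ m₀ : ℕ, ∀ m ≥ m₀, ∀ [NeZero m], ∀ X Y : (Fin 2 → ℤ) → Fin 2 → ℝ,
      (∀ ν, X ν ∈ Box.Icc (box m ν)) → (∀ ν, Y ν ∈ Box.Icc (box m ν)) →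
      ∑ ν ∈ admissibleIndex m unitSquareBox, (f (X ν) - f (Y ν)) / (m : ℝ) ^ 2 ≤ ε := by
  obtain ⟨m₀, hm₀⟩ := exists_nat_gt (1 / (hf.convergenceR (ε / 2) 0 0 : ℝ))
  have hr0 : 0 < (hf.convergenceR (ε / 2) 0 0 : ℝ) := (hf.convergenceR (ε / 2) 0 0).2
  refine ⟨m₀, fun m hm _ X Y hX hY => ?_⟩
  have hm0 : (0 : ℝ) < m := Nat.cast_pos.2 (NeZero.pos m)
  have hmr : 1 / (m : ℝ) ≤ hf.convergenceR (ε / 2) 0 0 := by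
    rw [div_le_iff₀ hm0]
    have : (m₀ : ℝ) ≤ m := by exact_mod_cast hm
    rw [div_lt_iff₀ hr0] at hm₀
    nlinarith
  have key : ∀ Z : (Fin 2 → ℤ) → Fin 2 → ℝ, ∀ hZ : ∀ ν, Z ν ∈ Box.Icc (box m ν),
      dist (∑ ν ∈ admissibleIndex m unitSquareBox, f (Z ν) / (m : ℝ) ^ 2)
        (BoxIntegral.integral unitSquareBox IntegrationParams.Riemann f BoxAdditiveMap.volume)
        ≤ ε / 2 := by
    intro Z hZ
    rw [← integralSum_gridPartition f hZ]
    refine hf.dist_integralSum_integral_le_of_memBaseSet (half_pos hε) (c := 0)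
      ⟨?_, fun _ => ?_, fun h => absurd h (by decide), fun h => absurd h (by decide)⟩ ?_
    · intro J hJ
      obtain ⟨ν, hν, rfl⟩ := mem_prepartition_boxes_iff.1 hJ
      -- For the Riemann integral the admissible radius is constant, so its value at `0` serves for
      -- every tag.
      rw [gridPartition_tag hZ hν, hf.convergenceR_cond (ε / 2) 0 rfl]
      exact fun x hx => (Metric.dist_le_diam_of_mem (Box.isBounded_Icc _) hx (hZ ν)).trans
        ((diam_boxIcc m ν).trans hmr)
    · intro J hJ
      obtain ⟨ν, hν, rfl⟩ := mem_prepartition_boxes_iff.1 hJ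
      rw [gridPartition_tag hZ hν]
      exact hZ ν
    · exact prepartition_isPartition m unitSquareBox_hasIntegralVertices
  have h1 := key X hX
  have h2 := key Y hY
  rw [Real.dist_eq, abs_le] at h1 h2
  simp only [sub_div, Finset.sum_sub_distrib]
  linarith [h1.2, h2.1]

/-- The closed square of side `1 / m` in `𝕋²` with lower left corner `c / m`. -/
def torusCell (m : ℕ) [NeZero m] (c : ZMod m × ZMod m) : Set (UnitAddCircle × UnitAddCircle) :=
  {p | ∃ s ∈ Set.Icc (0 : ℝ) (1 / m), ∃ t ∈ Set.Icc (0 : ℝ) (1 / m),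
    p = (ZMod.toAddCircle c.1 + (s : UnitAddCircle), ZMod.toAddCircle c.2 + (t : UnitAddCircle))}

/-- The oscillation of `F` on a closed grid square. -/
noncomputable def cellOsc (F : UnitAddCircle × UnitAddCircle → ℝ) (m : ℕ) [NeZero m]
    (c : ZMod m × ZMod m) : ℝ :=
  sSup {r | ∃ p ∈ torusCell m c, ∃ q ∈ torusCell m c, r = F p - F q}

variable {F : UnitAddCircle × UnitAddCircle → ℝ}

theorem bddAbove_cellOsc (hF : ∀ p, F p ∈ Set.Icc (0 : ℝ) 1) (m : ℕ) [NeZero m]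
    (c : ZMod m × ZMod m) :
    BddAbove {r | ∃ p ∈ torusCell m c, ∃ q ∈ torusCell m c, r = F p - F q} := by
  refine ⟨1, ?_⟩
  rintro _ ⟨p, -, q, -, rfl⟩
  linarith [(hF p).2, (hF q).1]

theorem abs_sub_le_cellOsc (hF : ∀ p, F p ∈ Set.Icc (0 : ℝ) 1) {m : ℕ} [NeZero m]
    {c : ZMod m × ZMod m} {p q : UnitAddCircle × UnitAddCircle} (hp : p ∈ torusCell m c)
    (hq : q ∈ torusCell m c) : |F p - F q| ≤ cellOsc F m c := by
  rw [abs_sub_le_iff]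
  exact ⟨le_csSup (bddAbove_cellOsc hF m c) ⟨p, hp, q, hq, rfl⟩,
    le_csSup (bddAbove_cellOsc hF m c) ⟨q, hq, p, hp, rfl⟩⟩

theorem corner_mem_torusCell (m : ℕ) [NeZero m] (c : ZMod m × ZMod m) :
    (ZMod.toAddCircle c.1, ZMod.toAddCircle c.2) ∈ torusCell m c :=
  ⟨0, ⟨le_rfl, by positivity⟩, 0, ⟨le_rfl, by positivity⟩, by simp⟩

theorem cellOsc_nonneg (hF : ∀ p, F p ∈ Set.Icc (0 : ℝ) 1) (m : ℕ) [NeZero m]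
    (c : ZMod m × ZMod m) : 0 ≤ cellOsc F m c :=
  (abs_nonneg _).trans
    (abs_sub_le_cellOsc hF (corner_mem_torusCell m c) (corner_mem_torusCell m c))

theorem sum_admissibleIndex_unitSquareBox {m : ℕ} [NeZero m] (h : ZMod m × ZMod m → ℝ) :
    ∑ ν ∈ admissibleIndex m unitSquareBox, h ((ν 0 : ZMod m), (ν 1 : ZMod m)) = ∑ c, h c := by
  have hm0 : (0 : ℝ) < m := Nat.cast_pos.2 (NeZero.pos m)
  have hmem : ∀ ν, ν ∈ admissibleIndex m unitSquareBox ↔ ∀ i, 0 ≤ ν i ∧ ν i < m := by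
    intro ν
    rw [mem_admissibleIndex_iff, Box.le_iff_bounds, Pi.le_def, Pi.le_def, ← forall_and]
    refine forall_congr' fun i => and_congr ?_ ?_
    · simp only [unitSquareBox, box_lower]
      rw [le_div_iff₀ hm0, zero_mul]
      exact_mod_cast Iff.rfl
    · simp only [unitSquareBox, box_upper]
      rw [div_le_one hm0]
      exact_mod_cast Int.add_one_le_iff
  refine Finset.sum_nbij' (fun ν => ((ν 0 : ZMod m), (ν 1 : ZMod m)))
    (fun c => ![(c.1.val : ℤ), (c.2.val : ℤ)]) (fun _ _ => Finset.mem_univ _) ?_ ?_ ?_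
    (fun _ _ => rfl)
  · intro c _
    rw [hmem]
    intro i
    fin_cases i
    · exact ⟨Int.natCast_nonneg _, Int.ofNat_lt.2 (ZMod.val_lt c.1)⟩
    · exact ⟨Int.natCast_nonneg _, Int.ofNat_lt.2 (ZMod.val_lt c.2)⟩
  · intro ν hν
    rw [hmem] at hν
    funext i
    fin_cases i
    · exact (ZMod.val_intCast _).trans (Int.emod_eq_of_lt (hν 0).1 (hν 0).2)
    · exact (ZMod.val_intCast _).trans (Int.emod_eq_of_lt (hν 1).1 (hν 1).2)
  · intro c _
    simp

/-- The Darboux criterion on the torus: the mean oscillation over fine grids is small. -/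
theorem exists_sum_cellOsc_le (hF : TorusRiemannIntegrable F)
    {ε : ℝ} (hε : 0 < ε) :
    ∃ m : ℕ, ∃ _ : NeZero m, ∑ c, cellOsc F m c / (m : ℝ) ^ 2 ≤ ε := by
  obtain ⟨m₀, hm₀⟩ := gridSum_sub_le_of_riemannIntegrable hF (half_pos hε)
  refine ⟨m₀ + 1, ⟨by omega⟩, ?_⟩
  set m := m₀ + 1 with hm
  have hm0 : (0 : ℝ) < m := Nat.cast_pos.2 (NeZero.pos m)
  have hex : ∀ c : ZMod m × ZMod m, ∃ p ∈ torusCell m c, ∃ q ∈ torusCell m c,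
      cellOsc F m c - ε / 2 < F p - F q := by
    intro c
    obtain ⟨_, ⟨p, hp, q, hq, rfl⟩, hlt⟩ := exists_lt_of_lt_csSup
      (s := {r | ∃ p ∈ torusCell m c, ∃ q ∈ torusCell m c, r = F p - F q})
      ⟨_, _, corner_mem_torusCell m c, _, corner_mem_torusCell m c, rfl⟩
      (show cellOsc F m c - ε / 2 < _ from sub_lt_self _ (half_pos hε))
    exact ⟨p, hp, q, hq, hlt⟩
  choose p hp q hq hpq using hex
  -- Integrability concerns the periodic lift, so the near-extremal points of the cells are lifted
  -- to tags in the closed boxes of the plane.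
  have hlift : ∀ z : ZMod m × ZMod m → UnitAddCircle × UnitAddCircle,
      (∀ c, z c ∈ torusCell m c) → ∃ X : (Fin 2 → ℤ) → Fin 2 → ℝ,
        (∀ ν, X ν ∈ Box.Icc (box m ν)) ∧ ∀ ν, ((X ν 0 : UnitAddCircle), (X ν 1 : UnitAddCircle)) =
          z ((ν 0 : ZMod m), (ν 1 : ZMod m)) := by
    intro z hz
    choose s hs t ht hst using hz
    refine ⟨fun ν => ![ν 0 / m + s ((ν 0 : ZMod m), (ν 1 : ZMod m)),
      ν 1 / m + t ((ν 0 : ZMod m), (ν 1 : ZMod m))], fun ν => ?_, fun ν => ?_⟩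
    · rw [Box.Icc_def, Set.mem_Icc, Pi.le_def, Pi.le_def, ← forall_and]
      have h1 := hs ((ν 0 : ZMod m), (ν 1 : ZMod m))
      have h2 := ht ((ν 0 : ZMod m), (ν 1 : ZMod m))
      intro i
      fin_cases i
      · simp only [box_lower, box_upper, add_div]
        exact ⟨by simpa using h1.1, by simpa using h1.2⟩
      · simp only [box_lower, box_upper, add_div]
        exact ⟨by simpa using h2.1, by simpa using h2.2⟩
    · rw [hst]
      simp [ZMod.toAddCircle_intCast]
  obtain ⟨X, hX, hXp⟩ := hlift p hp
  obtain ⟨Y, hY, hYq⟩ := hlift q hq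
  have h1 := hm₀ m (by omega) X Y hX hY
  simp only [hXp, hYq] at h1
  rw [sum_admissibleIndex_unitSquareBox (fun c => (F (p c) - F (q c)) / (m : ℝ) ^ 2)] at h1
  calc ∑ c, cellOsc F m c / (m : ℝ) ^ 2
      ≤ ∑ c, ((F (p c) - F (q c)) / (m : ℝ) ^ 2 + ε / 2 / (m : ℝ) ^ 2) := by
        refine Finset.sum_le_sum fun c _ => ?_
        rw [← add_div]
        gcongr
        linarith [hpq c]
    _ = ∑ c, (F (p c) - F (q c)) / (m : ℝ) ^ 2 + ε / 2 := by
        rw [Finset.sum_add_distrib]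
        congr 1
        simp only [Finset.sum_const, Finset.card_univ, Fintype.card_prod, ZMod.card, nsmul_eq_mul]
        push_cast
        field_simp
    _ ≤ ε := by linarith

end Darboux

/-! ### Continuous squeezes of Riemann integrable functions -/

instance isProbabilityMeasure_volume_unitAddCircle :
    IsProbabilityMeasure (volume : Measure UnitAddCircle) :=
  ⟨UnitAddCircle.measure_univ⟩

/-- A continuous partition of unity on the circle subordinate to the arcs of length `2 / m` around
the points `a / m`, obtained by translating one function. -/
theorem exists_circle_partitionOfUnity (m : ℕ) [NeZero m] :
    ∃ θ : ZMod m → C(UnitAddCircle, ℝ), (∀ a x, 0 ≤ θ a x) ∧ (∀ x, ∑ a, θ a x = 1) ∧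
      (∀ a, ∫ x, θ a x = 1 / m) ∧
      ∀ a x, θ a x ≠ 0 → ∃ j ∈ ({0, 1} : Finset (ZMod m)), ∃ t ∈ Set.Icc (0 : ℝ) (1 / m),
        x = ZMod.toAddCircle (a - j) + (t : UnitAddCircle) := by
  have hm0 : (0 : ℝ) < m := Nat.cast_pos.2 (NeZero.pos m)
  -- Tents of half-width `1 / m`, divided by their sum `T`; this also covers `m = 1`, where the
  -- single tent is not constant. As `T` is invariant under translation by `1 / m`, the `θ a` are
  -- translates of `θ 0` and share its integral.
  set τ : UnitAddCircle → ℝ := fun x => max 0 (1 - m * ‖x‖) with hτ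
  have hτc : Continuous τ := by fun_prop
  have hτ0 : ∀ x, 0 ≤ τ x := fun x => le_max_left _ _
  set T : UnitAddCircle → ℝ := fun x => ∑ b : ZMod m, τ (x - ZMod.toAddCircle b) with hT
  have hTc : Continuous T := by fun_prop
  have hTpos : ∀ x, 0 < T x := by
    intro x
    obtain ⟨r, rfl⟩ := QuotientAddGroup.mk_surjective x
    refine lt_of_lt_of_le ?_ (Finset.single_le_sum (fun b _ => hτ0 _)
      (Finset.mem_univ ((⌊m * r⌋ : ℤ) : ZMod m)))
    rw [ZMod.toAddCircle_intCast]
    refine lt_max_of_lt_right (sub_pos.2 ?_)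
    have h1 : ‖((r - ⌊m * r⌋ / m : ℝ) : UnitAddCircle)‖ ≤ |r - ⌊m * r⌋ / m| :=
      QuotientAddGroup.norm_mk_le_norm
    have h2 : |r - ⌊m * r⌋ / m| = (m * r - ⌊m * r⌋) / m := by
      rw [abs_of_nonneg]
      · field_simp
      · rw [sub_nonneg, div_le_iff₀ hm0, mul_comm]
        exact Int.floor_le _
    calc (m : ℝ) * ‖((r : UnitAddCircle) - ((⌊m * r⌋ / m : ℝ) : UnitAddCircle))‖
        ≤ m * ((m * r - ⌊m * r⌋) / m) := by
          rw [← h2]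
          gcongr
          exact h1
      _ = m * r - ⌊m * r⌋ := by field_simp
      _ < 1 := by linarith [Int.lt_floor_add_one ((m : ℝ) * r)]
  have hTshift : ∀ x (a : ZMod m), T (x - ZMod.toAddCircle a) = T x := by
    intro x a
    exact Fintype.sum_equiv (Equiv.addLeft a) _ _ fun b => by simp [sub_sub]
  set θ : ZMod m → C(UnitAddCircle, ℝ) := fun a =>
    ⟨fun x => τ (x - ZMod.toAddCircle a) / T x, by
      exact Continuous.div (by fun_prop) hTc fun x => (hTpos x).ne'⟩ with hθ
  have hsum : ∀ x, ∑ a, θ a x = 1 := by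
    intro x
    simp only [hθ, ContinuousMap.coe_mk, ← Finset.sum_div]
    exact div_self (hTpos x).ne'
  have hint : ∀ a, ∫ x, θ a x = ∫ x, θ 0 x := by
    intro a
    rw [← integral_sub_right_eq_self (fun x => θ 0 x) (ZMod.toAddCircle a)]
    simp [hθ, hTshift]
  refine ⟨θ, fun a x => div_nonneg (hτ0 _) (hTpos x).le, hsum, fun a => ?_, fun a x hx => ?_⟩
  · have h1 : ∫ x, ∑ b, θ b x = 1 := by simp [hsum]
    rw [integral_finsetSum _ fun b _ => integrable_continuousMap _ _] at h1
    simp only [hint, Finset.sum_const, Finset.card_univ, ZMod.card, nsmul_eq_mul] at h1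
    rw [hint a, eq_div_iff hm0.ne', mul_comm]
    exact h1
  · have h1 : (m : ℝ) * ‖x - ZMod.toAddCircle a‖ < 1 := by
      by_contra! h
      exact hx (by simp [hθ, hτ, max_eq_left (sub_nonpos.2 h)])
    obtain ⟨r, hr⟩ := QuotientAddGroup.mk_surjective (x - ZMod.toAddCircle a)
    have hr' : ((r : ℝ) : UnitAddCircle) = x - ZMod.toAddCircle a := hr
    rw [← hr', UnitAddCircle.norm_eq] at h1
    set t := r - round r with ht
    have htr : (t : UnitAddCircle) = x - ZMod.toAddCircle a := by
      rw [ht, AddCircle.coe_sub, hr']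
      simp
    have habs : |t| < 1 / m := by rwa [lt_div_iff₀ hm0, mul_comm]
    rw [abs_lt] at habs
    -- Right of `a / m` the point lies in the arc starting there; left of it, in the arc starting at
    -- `(a - 1) / m`.
    rcases le_total 0 t with h | h
    · exact ⟨0, by simp, t, ⟨h, habs.2.le⟩, by rw [htr]; simp⟩
    · refine ⟨1, by simp, t + 1 / m, ⟨by linarith, by linarith⟩, ?_⟩
      have h3 : ZMod.toAddCircle (1 : ZMod m) = ((1 / m : ℝ) : UnitAddCircle) := by
        simpa using ZMod.toAddCircle_intCast (N := m) 1
      rw [AddCircle.coe_add, htr, map_sub, h3]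
      abel

/-- A grid point is a vertex of all four cells around it, so it shares a cell with any point where
its bump is nonzero. -/
theorem mem_torusCell_sub {m : ℕ} [NeZero m] (c : ZMod m × ZMod m) {i j : ZMod m}
    (hi : i ∈ ({0, 1} : Finset (ZMod m))) (hj : j ∈ ({0, 1} : Finset (ZMod m))) :
    (ZMod.toAddCircle c.1, ZMod.toAddCircle c.2) ∈ torusCell m (c.1 - i, c.2 - j) := by
  have h3 : ZMod.toAddCircle (1 : ZMod m) = ((1 / m : ℝ) : UnitAddCircle) := by
    simpa using ZMod.toAddCircle_intCast (N := m) 1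
  have key : ∀ (a i : ZMod m), i ∈ ({0, 1} : Finset (ZMod m)) → ∃ s ∈ Set.Icc (0 : ℝ) (1 / m),
      ZMod.toAddCircle a = ZMod.toAddCircle (a - i) + (s : UnitAddCircle) := by
    intro a i hi
    simp only [Finset.mem_insert, Finset.mem_singleton] at hi
    rcases hi with rfl | rfl
    · exact ⟨0, ⟨le_rfl, by positivity⟩, by simp⟩
    · exact ⟨1 / m, ⟨by positivity, le_rfl⟩, by rw [map_sub, h3]; simp⟩
  obtain ⟨s, hs, h1⟩ := key c.1 i hi
  obtain ⟨t, ht, h2⟩ := key c.2 j hj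
  exact ⟨s, hs, t, ht, Prod.ext h1 h2⟩

/-- Riemann integrable functions are squeezed between continuous ones. -/
theorem TorusRiemannIntegrable.exists_squeeze {F : UnitAddCircle × UnitAddCircle → ℝ}
    (hF : TorusRiemannIntegrable F) (hF01 : ∀ p, F p ∈ Set.Icc (0 : ℝ) 1) {ε : ℝ} (hε : 0 < ε) :
    ∃ g u : C(UnitAddCircle × UnitAddCircle, ℝ),
      (∀ p, g p ∈ Set.Icc (0 : ℝ) 1) ∧ (∀ p, |F p - g p| ≤ u p) ∧ ∫ p, u p ≤ ε := by
  obtain ⟨m, hm, hosc⟩ := exists_sum_cellOsc_le hF (by positivity : 0 < ε / 4)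
  obtain ⟨θ, hθ0, hθ1, hθi, hθs⟩ := exists_circle_partitionOfUnity m
  have hm0 : (0 : ℝ) < m := Nat.cast_pos.2 (NeZero.pos m)
  set E : Finset (ZMod m) := {0, 1} with hE
  -- The oscillations of the four cells around the corner together bound `|F - F(corner)|` wherever
  -- the bump is nonzero.
  set O : ZMod m × ZMod m → ℝ := fun c => ∑ i ∈ E, ∑ j ∈ E, cellOsc F m (c.1 - i, c.2 - j) with hO
  set corner : ZMod m × ZMod m → UnitAddCircle × UnitAddCircle := fun c =>
    (ZMod.toAddCircle c.1, ZMod.toAddCircle c.2) with hcorner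
  have hθθ0 : ∀ (c : ZMod m × ZMod m) (p : UnitAddCircle × UnitAddCircle),
      0 ≤ θ c.1 p.1 * θ c.2 p.2 := fun c p => mul_nonneg (hθ0 _ _) (hθ0 _ _)
  have hθθ1 : ∀ p : UnitAddCircle × UnitAddCircle, ∑ c : ZMod m × ZMod m,
      θ c.1 p.1 * θ c.2 p.2 = 1 := by
    intro p
    rw [Fintype.sum_prod_type]
    simp [← Finset.mul_sum, hθ1]
  have hOsc : ∀ c p, θ c.1 p.1 * θ c.2 p.2 ≠ 0 → |F p - F (corner c)| ≤ O c := by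
    intro c p h
    obtain ⟨i, hi, s, hs, hps⟩ := hθs _ _ (left_ne_zero_of_mul h)
    obtain ⟨j, hj, t, ht, hpt⟩ := hθs _ _ (right_ne_zero_of_mul h)
    have h1 : |F p - F (corner c)| ≤ cellOsc F m (c.1 - i, c.2 - j) :=
      abs_sub_le_cellOsc hF01 ⟨s, hs, t, ht, Prod.ext hps hpt⟩ (mem_torusCell_sub c hi hj)
    refine h1.trans (le_trans ?_ (Finset.single_le_sum (f := fun i => ∑ j ∈ E,
      cellOsc F m (c.1 - i, c.2 - j))
      (fun i _ => Finset.sum_nonneg fun j _ => cellOsc_nonneg hF01 _ _) hi))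
    exact Finset.single_le_sum (f := fun j => cellOsc F m (c.1 - i, c.2 - j))
      (fun j _ => cellOsc_nonneg hF01 _ _) hj
  refine ⟨⟨fun p => ∑ c : ZMod m × ZMod m, F (corner c) * (θ c.1 p.1 * θ c.2 p.2), by fun_prop⟩,
    ⟨fun p => ∑ c : ZMod m × ZMod m, O c * (θ c.1 p.1 * θ c.2 p.2), by fun_prop⟩,
    fun p => ⟨?_, ?_⟩, fun p => ?_, ?_⟩
  · exact Finset.sum_nonneg fun c _ => mul_nonneg (hF01 _).1 (hθθ0 c p)
  · exact (Finset.sum_le_sum fun c _ => mul_le_of_le_one_left (hθθ0 c p) (hF01 _).2).trans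
      (hθθ1 p).le
  · have h1 : F p = ∑ c : ZMod m × ZMod m, F p * (θ c.1 p.1 * θ c.2 p.2) := by
      rw [← Finset.mul_sum, hθθ1, mul_one]
    simp only [ContinuousMap.coe_mk]
    rw [h1, ← Finset.sum_sub_distrib]
    refine (Finset.abs_sum_le_sum_abs _ _).trans (Finset.sum_le_sum fun c _ => ?_)
    rw [← sub_mul, abs_mul, abs_of_nonneg (hθθ0 c p)]
    by_cases h : θ c.1 p.1 * θ c.2 p.2 = 0
    · simp [h]
    · exact mul_le_mul_of_nonneg_right (hOsc c p h) (hθθ0 c p)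
  · have h1 : ∀ c : ZMod m × ZMod m,
        ∫ p : UnitAddCircle × UnitAddCircle, O c * (θ c.1 p.1 * θ c.2 p.2) = O c / (m : ℝ) ^ 2 := by
      intro c
      rw [integral_const_mul, Measure.volume_eq_prod,
        integral_prod_mul (fun x => θ c.1 x) (fun y => θ c.2 y), hθi, hθi]
      field_simp
    have h2 : ∀ i j : ZMod m, ∑ c : ZMod m × ZMod m, cellOsc F m (c.1 - i, c.2 - j) =
        ∑ c, cellOsc F m c := fun i j =>
      Fintype.sum_equiv ((Equiv.subRight i).prodCongr (Equiv.subRight j)) _ _ fun c => rfl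
    -- Only an inequality, since `0 = 1` when `m = 1`. Summing `O` counts each cell at most four
    -- times, whence the `ε / 4` above.
    have hcard : (E.card : ℝ) ≤ 2 := by exact_mod_cast Finset.card_le_two
    have hosc0 : 0 ≤ ∑ c, cellOsc F m c / (m : ℝ) ^ 2 :=
      Finset.sum_nonneg fun c _ => div_nonneg (cellOsc_nonneg hF01 m c) (by positivity)
    simp only [ContinuousMap.coe_mk]
    rw [integral_finsetSum _ fun c _ => integrable_continuousMap _
      (⟨fun p => O c * (θ c.1 p.1 * θ c.2 p.2), by fun_prop⟩ : C(UnitAddCircle × UnitAddCircle, ℝ))]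
    have h3 : ∑ c, O c = E.card * (E.card * ∑ c, cellOsc F m c) := by
      simp only [hO]
      rw [Finset.sum_comm]
      have h4 : ∀ i : ZMod m, ∑ c : ZMod m × ZMod m, ∑ j ∈ E, cellOsc F m (c.1 - i, c.2 - j) =
          E.card * ∑ c, cellOsc F m c := by
        intro i
        rw [Finset.sum_comm]
        simp only [h2, Finset.sum_const, nsmul_eq_mul]
      simp only [h4, Finset.sum_const, nsmul_eq_mul]
    simp only [h1]
    rw [← Finset.sum_div, h3]
    rw [← Finset.sum_div] at hosc hosc0
    calc (E.card : ℝ) * (E.card * ∑ c, cellOsc F m c) / (m : ℝ) ^ 2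
        = E.card * (E.card * ((∑ c, cellOsc F m c) / (m : ℝ) ^ 2)) := by ring
      _ ≤ 2 * (2 * (ε / 4)) := by gcongr
      _ = ε := by ring

/-- As `g` and `α` lie in `[0,1]`, the new approximant `g - α` has modulus at most `1`. Taking `α =
0` gives `F` itself. -/
theorem TorusRiemannIntegrable.hasContinuousSqueeze_sub_const
    {F : UnitAddCircle × UnitAddCircle → ℝ} (hF : TorusRiemannIntegrable F)
    (hF01 : ∀ p, F p ∈ Set.Icc (0 : ℝ) 1) {α : ℝ} (hα : α ∈ Set.Icc (0 : ℝ) 1) :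
    HasContinuousSqueeze (fun p => F p - α) := by
  intro ε hε
  obtain ⟨g, u, hg, hFg, hu⟩ := hF.exists_squeeze hF01 hε
  refine ⟨g - ContinuousMap.const _ α, u, fun p => ?_, fun p => by simpa using hFg p, hu⟩
  have h := hg p
  simp only [ContinuousMap.sub_apply, ContinuousMap.const_apply, abs_le]
  exact ⟨by linarith [h.1, hα.2], by linarith [h.2, hα.1]⟩

/-! ### Phases combining a linear form and its power -/

section PowerPhase

open Polynomial

variable {I : Type*} [Fintype I] (G : ℕ+ → Type*) [∀ N, AddCommGroup (G N)] [∀ N, Fintype (G N)]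
  (L : ∀ N : ℕ+, I → G N →+ ZMod N)

/-- As `j ≥ 1`, the linear terms do not reach degree `j + 1`, so only `b` enters the nonvanishing
condition. -/
theorem tendsto_expect_powerPhase_zero {j : ℕ} (hj : 1 ≤ j) (v : Fin (j + 1) → ∀ N, G N)
    (c : Fin (j + 1) → I → ℤ) (hL : ∀ N l i, L N i (v l N) = c l i) (a b : I → ℤ)
    (hne : ∑ i, b i * ∏ l, c l i ≠ 0) :
    Tendsto (fun N : ℕ+ => 𝔼 x : G N, unitChar (∑ i, (a i • ZMod.toAddCircle (L N i x) +
      b i • ZMod.toAddCircle (L N i x ^ (j + 1))))) atTop (𝓝 0) := by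
  have hcoeff : ∀ i, (C (a i) * X + C (b i) * X ^ (j + 1) : ℤ[X]).coeff (j + 1) = b i := by
    intro i
    rw [coeff_add, coeff_C_mul, coeff_C_mul, coeff_X, coeff_X_pow_self, if_neg (by omega)]
    simp
  have h := tendsto_expect_polynomialPhase_zero G L j v c hL
    (fun i => C (a i) * X + C (b i) * X ^ (j + 1))
    (fun i => natDegree_add_le_of_degree_le
      ((natDegree_C_mul_le _ _).trans (natDegree_X_le.trans (by omega)))
      (natDegree_C_mul_X_pow_le _ _)) (by simpa only [hcoeff] using hne)
  refine h.congr fun N => Finset.expect_congr rfl fun x _ => ?_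
  rw [map_sum]
  congr 1
  refine Finset.sum_congr rfl fun i _ => ?_
  rw [← map_zsmul (ZMod.toAddCircle : ZMod N →+ _), ← map_zsmul (ZMod.toAddCircle : ZMod N →+ _),
    ← map_add]
  simp

theorem tendsto_expect_linearPhase_zero (v : ∀ N, G N) (c : I → ℤ)
    (hL : ∀ N i, L N i (v N) = c i) (a : I → ℤ) (hne : ∑ i, a i * c i ≠ 0) :
    Tendsto (fun N : ℕ+ => 𝔼 x : G N, unitChar (∑ i, a i • ZMod.toAddCircle (L N i x))) atTop
      (𝓝 0) := by
  have h := tendsto_expect_polynomialPhase_zero G L 0 (fun _ => v) (fun _ => c)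
    (fun N _ i => hL N i) (fun i => C (a i) * X)
    (fun i => (natDegree_C_mul_le _ _).trans natDegree_X_le) (by simpa using hne)
  refine h.congr fun N => Finset.expect_congr rfl fun x _ => ?_
  rw [map_sum]
  congr 1
  refine Finset.sum_congr rfl fun i _ => ?_
  rw [← map_zsmul]
  simp

end PowerPhase

/-! ### Nontrivial characters and Haar measure -/

/-- Translating by `w` multiplies the integral by `unitChar (χ w) ≠ 1`. -/
theorem integral_unitChar_eq_zero {W : Type*} [AddGroup W] [MeasurableSpace W] [MeasurableAdd W]
    (ν : Measure W) [ν.IsAddLeftInvariant] (χ : W →+ UnitAddCircle) {w : W} (hw : χ w ≠ 0) :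
    ∫ z, unitChar (χ z) ∂ν = 0 := by
  have h := integral_add_left_eq_self (μ := ν) (fun z => unitChar (χ z)) w
  simp only [map_add, unitChar_add, integral_const_mul] at h
  by_contra h0
  exact hw (unitChar_eq_one_iff.1 (mul_right_cancel₀ h0 (h.trans (one_mul _).symm)))

theorem exists_zsmul_ne_zero {c : ℤ} (hc : c ≠ 0) : ∃ t : UnitAddCircle, c • t ≠ 0 := by
  -- Then `c • t` is the class of `1 / 2`.
  refine ⟨((1 / (2 * c) : ℝ) : UnitAddCircle), fun h => ?_⟩
  have hc' : (c : ℝ) ≠ 0 := by exact_mod_cast hc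
  rw [← AddCircle.coe_zsmul, AddCircle.coe_eq_zero_iff] at h
  obtain ⟨n, hn⟩ := h
  simp only [zsmul_eq_mul, mul_one] at hn
  have h2 : (n : ℝ) * 2 = 1 := by
    rw [hn]
    field_simp
  have h3 : n * 2 = 1 := by exact_mod_cast h2
  omega

instance isAddHaarMeasure_volume_torus :
    (volume : Measure (UnitAddCircle × UnitAddCircle)).IsAddHaarMeasure :=
  inferInstanceAs ((volume : Measure UnitAddCircle).prod volume).IsAddHaarMeasure

instance isProbabilityMeasure_volume_torus :
    IsProbabilityMeasure (volume : Measure (UnitAddCircle × UnitAddCircle)) :=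
  inferInstanceAs (IsProbabilityMeasure ((volume : Measure UnitAddCircle).prod volume))

/-! ### Equidistribution of progressions in `V` -/

section ArithmeticProgression

instance measurableAdd_apBinomialSubgroup (k : ℕ) : MeasurableAdd (apBinomialSubgroup k) :=
  ContinuousAdd.measurableAdd

instance isAddHaarMeasure_apBinomialMeasure (k : ℕ) : (apBinomialMeasure k).IsAddHaarMeasure :=
  inferInstanceAs (Measure.addHaarMeasure ⊤).IsAddHaarMeasure

instance isProbabilityMeasure_apBinomialMeasure (k : ℕ) :
    IsProbabilityMeasure (apBinomialMeasure k) :=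
  ⟨Measure.addHaarMeasure_self⟩

theorem mem_apBinomialSubgroup_iff {j : ℕ}
    {p : (Fin (j + 3) → UnitAddCircle) × (Fin (j + 3) → UnitAddCircle)} :
    p ∈ apBinomialSubgroup (j + 3) ↔ (∃ x d, ∀ i, p.1 i = x + (i : ℕ) • d) ∧
      ∑ i : Fin (j + 3), ((-1 : ℤ) ^ (i : ℕ) * ((j + 2).choose (i : ℕ) : ℤ)) • p.2 i = 0 := by
  refine and_congr ⟨fun h => ⟨p.1 0, p.1 1 - p.1 0, ?_⟩, ?_⟩ Iff.rfl
  · have key : ∀ i : ℕ, ∀ hi : i + 1 < j + 3,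
        p.1 ⟨i, by omega⟩ = p.1 0 + i • (p.1 1 - p.1 0) ∧
        p.1 ⟨i + 1, hi⟩ = p.1 0 + (i + 1) • (p.1 1 - p.1 0) := by
      intro i
      induction i with
      | zero =>
        intro hi
        refine ⟨by simp, ?_⟩
        rw [show (⟨0 + 1, hi⟩ : Fin (j + 3)) = 1 from rfl, zero_add, one_smul]
        abel
      | succ i ih =>
        intro hi
        obtain ⟨h1, h2⟩ := ih (by omega)
        refine ⟨h2, ?_⟩
        have h3 := h i (by omega)
        rw [sub_eq_sub_iff_add_eq_add] at h3
        have h4 := eq_sub_of_add_eq h3.symm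
        rw [h4, h1, h2]
        simp only [add_smul]
        abel
    intro i
    obtain ⟨i, hi⟩ := i
    rcases Nat.lt_or_ge (i + 1) (j + 3) with h' | h'
    · exact (key i h').1
    · obtain rfl : i = j + 1 + 1 := by omega
      exact (key (j + 1) (by omega)).2
  · rintro ⟨x, d, h⟩ i hi
    rw [h, h, h]
    simp only [add_smul]
    abel

theorem sum_alternating_choose_smul_const (j : ℕ) (y : UnitAddCircle) :
    ∑ i : Fin (j + 3), ((-1 : ℤ) ^ (i : ℕ) * ((j + 2).choose (i : ℕ) : ℤ)) • y = 0 := by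
  rw [← Finset.sum_smul, Fin.sum_univ_eq_sum_range
    (fun i => (-1 : ℤ) ^ i * ((j + 2).choose i : ℤ)), Int.alternating_sum_range_choose_of_ne]
  · simp
  · omega

open Polynomial in
-- Up to sign this is the `(j + 2)`-nd difference of a polynomial of degree at most `j + 1`. It
-- places the sample points in `V`.
theorem sum_alternating_choose_mul_pow {R : Type*} [CommRing R] (j : ℕ) (n d : R) :
    ∑ i : Fin (j + 3), ((-1 : ℤ) ^ (i : ℕ) * ((j + 2).choose (i : ℕ) : ℤ)) •
      (n + (i : ℕ) • d) ^ (j + 1) = 0 := by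
  have hlin : (C n + C d * X : R[X]).natDegree ≤ 1 :=
    natDegree_add_le_of_degree_le (by simp) ((natDegree_C_mul_le _ _).trans natDegree_X_le)
  have hdeg : ((C n + C d * X) ^ (j + 1) : R[X]).natDegree < j + 2 :=
    (natDegree_pow_le_of_le (j + 1) hlin).trans_lt (by omega)
  have h := congr_fun (Polynomial.fwdDiff_iter_eq_zero_of_degree_lt hdeg) 0
  rw [fwdDiff_iter_eq_sum_shift, Pi.zero_apply] at h
  rw [Fin.sum_univ_eq_sum_range (fun i => ((-1 : ℤ) ^ i * ((j + 2).choose i : ℤ)) •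
    (n + i • d) ^ (j + 1))]
  rw [← smul_zero ((-1 : ℤ) ^ (j + 2)), ← h, Finset.smul_sum]
  refine Finset.sum_congr rfl fun i hi => ?_
  have hi' : i ≤ j + 2 := Nat.lt_succ_iff.1 (Finset.mem_range.1 hi)
  rw [smul_smul]
  congr 1
  · rw [← mul_assoc, ← pow_add, show j + 2 + (j + 2 - i) = i + 2 * (j + 2 - i) by omega, pow_add,
      pow_mul]
    simp
  · simp only [eval_pow, eval_add, eval_mul, eval_C, eval_X, zero_add, nsmul_eq_mul, mul_one,
      mul_comm d]

/-- The sample point of `V` given by the progression with first term `s.1` and step `s.2`. -/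
noncomputable def apSamplePoint (j : ℕ) (N : ℕ) [NeZero N] (s : ZMod N × ZMod N) :
    apBinomialSubgroup (j + 3) :=
  ⟨(fun i => ZMod.toAddCircle (s.1 + (i : ℕ) • s.2),
    fun i => ZMod.toAddCircle ((s.1 + (i : ℕ) • s.2) ^ (j + 1))), by
    refine mem_apBinomialSubgroup_iff.2 ⟨⟨ZMod.toAddCircle s.1, ZMod.toAddCircle s.2,
      fun i => (map_add _ _ _).trans (congrArg _ (map_nsmul _ _ _))⟩, ?_⟩
    simp only [← map_zsmul, ← map_sum]
    rw [sum_alternating_choose_mul_pow, map_zero]⟩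

/-- A continuous surjective homomorphism of compact groups carries Haar probability to Haar
probability. Surjectivity comes from the constant points, which lie in `V`. -/
theorem measurePreserving_apBinomialSubgroup_apply {j : ℕ} (i : Fin (j + 3)) :
    MeasurePreserving (fun v : apBinomialSubgroup (j + 3) => (v.1.1 i, v.1.2 i))
      (apBinomialMeasure (j + 3)) volume := by
  let f : apBinomialSubgroup (j + 3) →+ UnitAddCircle × UnitAddCircle :=
    { toFun := fun v => (v.1.1 i, v.1.2 i)
      map_zero' := rfl
      map_add' := fun _ _ => rfl }
  refine AddMonoidHom.measurePreserving (f := f) ?_ ?_ (by simp)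
  · exact Continuous.prodMk ((continuous_apply i).comp (continuous_fst.comp continuous_subtype_val))
      ((continuous_apply i).comp (continuous_snd.comp continuous_subtype_val))
  · rintro ⟨x, y⟩
    exact ⟨⟨(fun _ => x, fun _ => y), mem_apBinomialSubgroup_iff.2
      ⟨⟨x, 0, fun _ => by simp⟩, sum_alternating_choose_smul_const j y⟩⟩, rfl⟩

/-- On `V`, the last coordinate `y_k` can be eliminated from an integral linear form. -/
theorem exists_eliminate_last {j : ℕ} (b : Fin (j + 3) → ℤ) :
    ∃ c : Fin (j + 3) → ℤ, c (Fin.last _) = 0 ∧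
      ∀ v ∈ apBinomialSubgroup (j + 3), ∑ i, b i • v.2 i = ∑ i, c i • v.2 i := by
  -- The multiple of the defining relation that cancels the last entry: its coefficient of `y_k` is
  -- `(-1) ^ (j + 2)`, which is its own inverse.
  refine ⟨fun i => b i - (-1) ^ (j + 2) * b (Fin.last _) *
    ((-1 : ℤ) ^ (i : ℕ) * ((j + 2).choose (i : ℕ) : ℤ)), ?_, fun v hv => ?_⟩
  · have h : (-1 : ℤ) ^ (j + 2) * (-1) ^ (j + 2) = 1 := by
      rw [← pow_add, ← two_mul, pow_mul]
      simp
    simp only [Fin.val_last, Nat.choose_self, Nat.cast_one, mul_one]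
    linear_combination (-b (Fin.last _)) * h
  · have h := (mem_apBinomialSubgroup_iff.1 hv).2
    simp only [sub_smul, Finset.sum_sub_distrib, mul_smul (_ * _ : ℤ) (_ * _ : ℤ),
      ← Finset.smul_sum, h, smul_zero, sub_zero]

/-- The character of `V` with frequencies `a` in the `x`-variables and `b` in the `y`-variables. -/
noncomputable def apCharacter (j : ℕ) (a b : Fin (j + 3) → ℤ) :
    apBinomialSubgroup (j + 3) →+ UnitAddCircle where
  toFun v := ∑ i, (a i • v.1.1 i + b i • v.1.2 i)
  map_zero' := by simp
  map_add' v w := by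
    rw [← Finset.sum_add_distrib]
    refine Finset.sum_congr rfl fun i _ => ?_
    simp only [AddSubgroup.coe_add, Prod.fst_add, Prod.snd_add, Pi.add_apply, smul_add]
    abel

/-- After eliminating `y_k`, the character is trivial on `V` exactly when no `y`-frequency is left
and the `x`-part vanishes in both the first term and the step. Otherwise its integral is `0` and a
Weyl sum must be shown to vanish. -/
theorem tendsto_expect_apCharacter {j : ℕ} (hj : 1 ≤ j) (a b : Fin (j + 3) → ℤ) :
    Tendsto (fun N : ℕ+ => 𝔼 s, unitChar (apCharacter j a b (apSamplePoint j N s))) atTop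
      (𝓝 (∫ v, unitChar (apCharacter j a b v) ∂(apBinomialMeasure (j + 3)))) := by
  obtain ⟨c, hclast, hc⟩ := exists_eliminate_last b
  have hab : apCharacter j a b = apCharacter j a c := by
    ext v
    simp only [apCharacter, AddMonoidHom.coe_mk, ZeroHom.coe_mk, Finset.sum_add_distrib]
    rw [hc v.1 v.2]
  rw [hab]
  let L : ∀ N : ℕ+, Fin (j + 3) → (ZMod N × ZMod N) →+ ZMod N := fun N i =>
    AddMonoidHom.fst _ _ + (i : ℕ) • AddMonoidHom.snd _ _
  have hLapply : ∀ N i s, L N i s = s.1 + (i : ℕ) • s.2 := fun N i s => rfl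
  have hzero : ∀ {w : apBinomialSubgroup (j + 3)}, apCharacter j a c w ≠ 0 →
      ∫ v, unitChar (apCharacter j a c v) ∂(apBinomialMeasure (j + 3)) = 0 := fun hw =>
    integral_unitChar_eq_zero _ (apCharacter j a c) hw
  by_cases hc0 : c = 0
  · have hlin : ∀ x d : UnitAddCircle, ∀ (v : apBinomialSubgroup (j + 3)),
        (∀ i, v.1.1 i = x + (i : ℕ) • d) →
        apCharacter j a c v = (∑ i, a i) • x + (∑ i, a i * (i : ℕ)) • d := by
      intro x d v hv
      simp [apCharacter, hc0, hv, Finset.sum_smul, Finset.sum_add_distrib, mul_smul]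
    let w : UnitAddCircle → UnitAddCircle → apBinomialSubgroup (j + 3) := fun x d =>
      ⟨(fun i => x + (i : ℕ) • d, 0), mem_apBinomialSubgroup_iff.2 ⟨⟨x, d, fun _ => rfl⟩, by simp⟩⟩
    have hsample : ∀ (N : ℕ+) (s : ZMod N × ZMod N), apCharacter j a c (apSamplePoint j N s) =
        ∑ i, a i • ZMod.toAddCircle (L N i s) := by
      intro N s
      simp [apCharacter, hc0, apSamplePoint, hLapply]
    by_cases hA : ∑ i, a i = 0
    · by_cases hB : ∑ i, a i * ((i : ℕ) : ℤ) = 0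
      · have htriv : ∀ v, apCharacter j a c v = 0 := by
          intro v
          obtain ⟨x, d, hv⟩ := (mem_apBinomialSubgroup_iff.1 v.2).1
          rw [hlin x d v hv, hA, hB, zero_smul, zero_smul, add_zero]
        simp [htriv, unitChar_zero]
      · obtain ⟨t, ht⟩ := exists_zsmul_ne_zero hB
        rw [hzero (w := w 0 t) (by rw [hlin 0 t _ fun _ => rfl]; simpa using ht)]
        simp only [hsample]
        exact tendsto_expect_linearPhase_zero (fun N : ℕ+ => ZMod N × ZMod N) L (fun _ => (0, 1))
          (fun i => ((i : ℕ) : ℤ)) (fun N i => by simp [hLapply]) a hB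
    · obtain ⟨t, ht⟩ := exists_zsmul_ne_zero hA
      rw [hzero (w := w t 0) (by rw [hlin t 0 _ fun _ => rfl]; simpa using ht)]
      simp only [hsample]
      exact tendsto_expect_linearPhase_zero (fun N : ℕ+ => ZMod N × ZMod N) L (fun _ => (1, 0))
        (fun i => 1) (fun N i => by simp [hLapply]) a (by simpa using hA)
  · obtain ⟨i₁, hi₁⟩ := Function.ne_iff.1 hc0
    obtain ⟨i₀, rfl⟩ := Fin.exists_castSucc_eq.2 (show i₁ ≠ Fin.last _ from
      fun h => hi₁ (by rw [h, hclast]; rfl))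
    obtain ⟨t, ht⟩ := exists_zsmul_ne_zero hi₁
    -- The last coordinate is chosen to restore the relation of `V` when `t` is placed at `i₀`;
    -- since `c` vanishes there, the character still takes the value `c i₀ • t ≠ 0`.
    let sgn : ℤ := -(-1) ^ (j + 2) * ((-1) ^ (i₀ : ℕ) * ((j + 2).choose (i₀ : ℕ) : ℤ))
    let y : Fin (j + 3) → UnitAddCircle := Pi.single i₀.castSucc t + Pi.single (Fin.last _) (sgn • t)
    have hy : ∀ b : Fin (j + 3) → ℤ, ∑ i, b i • y i =
        b i₀.castSucc • t + b (Fin.last _) • sgn • t := by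
      intro b
      simp [y, smul_add, Finset.sum_add_distrib, Pi.single_apply, smul_ite]
    have hw : ((0, y) : (Fin (j + 3) → UnitAddCircle) × (Fin (j + 3) → UnitAddCircle)) ∈
        apBinomialSubgroup (j + 3) := by
      refine mem_apBinomialSubgroup_iff.2 ⟨⟨0, 0, fun i => by simp⟩, ?_⟩
      rw [hy fun i => (-1 : ℤ) ^ (i : ℕ) * ((j + 2).choose (i : ℕ) : ℤ), smul_smul, ← add_smul]
      have h : (-1 : ℤ) ^ (j + 2) * (-1) ^ (j + 2) = 1 := by
        rw [← pow_add, ← two_mul, pow_mul]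
        simp
      convert zero_smul ℤ t
      simp only [sgn, Fin.val_last, Fin.val_castSucc, Nat.choose_self, Nat.cast_one, mul_one]
      linear_combination (-(-1) ^ (i₀ : ℕ) * ((j + 2).choose (i₀ : ℕ) : ℤ)) * h
    rw [hzero (w := ⟨_, hw⟩) (by simpa [apCharacter, hy, hclast] using ht)]
    -- One direction `(-i', 1)` for each of the `j + 1` indices `i'` other than `i₀` and the last.
    -- The form of index `i` takes the value `i - i'` on it, so the product kills every such `i'`;
    -- the last index drops out because `c` vanishes there.
    have h := tendsto_expect_powerPhase_zero (fun N : ℕ+ => ZMod N × ZMod N) L hj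
      (fun l _ => (-((i₀.succAbove l : ℕ) : ZMod _), 1))
      (fun l i => ((i : ℕ) : ℤ) - ((i₀.succAbove l : ℕ) : ℤ))
      (fun N l i => by simp [hLapply]; ring) a c ?_
    · exact h.congr fun N => Finset.expect_congr rfl fun s _ => rfl
    · rw [Finset.sum_eq_single i₀.castSucc]
      · refine mul_ne_zero hi₁ (Finset.prod_ne_zero_iff.2 fun l _ => ?_)
        rw [sub_ne_zero]
        intro h
        exact Fin.succAbove_ne i₀ l (Fin.ext (by simpa using h.symm))
      · intro i _ hi
        by_cases hil : i = Fin.last _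
        · rw [hil, hclast, zero_mul]
        · obtain ⟨i', rfl⟩ := Fin.exists_castSucc_eq.2 hil
          obtain ⟨l, rfl⟩ := Fin.exists_succAbove_eq (show i' ≠ i₀ from fun h => hi (by rw [h]))
          rw [Finset.prod_eq_zero (Finset.mem_univ l) (by simp), mul_zero]
      · simp

theorem apDensity_torusSample (j : ℕ) (F : UnitAddCircle × UnitAddCircle → ℝ) (N : ℕ) [NeZero N] :
    apDensity (j + 3) (torusSample (j + 3) F N) =
      𝔼 s, ∏ i, F ((apSamplePoint j N s).1.1 i, (apSamplePoint j N s).1.2 i) := by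
  rw [apDensity, ← Finset.expect_product']
  rfl

theorem integrable_apBinomialProduct (j : ℕ) {F : UnitAddCircle × UnitAddCircle → ℝ}
    (hF1 : ∀ p, |F p| ≤ 1) (hF : HasContinuousSqueeze F) :
    Integrable (apBinomialProduct (j + 3) F) (apBinomialMeasure (j + 3)) :=
  integrable_prod_comp (Q := fun (v : apBinomialSubgroup (j + 3)) i => (v.1.1 i, v.1.2 i))
    measurePreserving_apBinomialSubgroup_apply hF1 hF.aestronglyMeasurable

theorem tendsto_apDensity_torusSample {j : ℕ} (hj : 1 ≤ j)
    {F : UnitAddCircle × UnitAddCircle → ℝ} (hF1 : ∀ p, |F p| ≤ 1) (hF : HasContinuousSqueeze F) :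
    Tendsto (fun N : ℕ+ => apDensity (j + 3) (torusSample (j + 3) F (N : ℕ))) atTop
      (𝓝 (torusApDensity (j + 3) F)) := by
  simp only [apDensity_torusSample]
  exact tendsto_expect_prod_of_characters (fun N : ℕ+ => ZMod N × ZMod N)
    (fun N s i => ((apSamplePoint j N s).1.1 i, (apSamplePoint j N s).1.2 i))
    (Q := fun (v : apBinomialSubgroup (j + 3)) i => (v.1.1 i, v.1.2 i))
    measurePreserving_apBinomialSubgroup_apply (tendsto_expect_apCharacter hj) hF1 hF

end ArithmeticProgression

/-! ### Equidistribution of cubes and the Gowers norm -/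

section Gowers

/-- The vertex `n - ω · h` of the cube with base point `n` and edges `h`. -/
def cubeVertex {A : Type*} [AddCommGroup A] {d : ℕ} (ω : Fin d → Bool) : (Fin d → A) × A →+ A :=
  AddMonoidHom.mk' (fun s => s.2 - ∑ i, if ω i then s.1 i else 0) fun s t => by
    have h : ∀ i, (if ω i then (s + t).1 i else 0) =
        (if ω i then s.1 i else 0) + if ω i then t.1 i else 0 := by
      intro i
      split_ifs <;> simp
    simp only [h, Finset.sum_add_distrib, Prod.snd_add]
    abel

theorem cubeVertex_apply {A : Type*} [AddCommGroup A] {d : ℕ} (ω : Fin d → Bool)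
    (s : (Fin d → A) × A) : cubeVertex ω s = s.2 - ∑ i, if ω i then s.1 i else 0 := rfl

theorem map_cubeVertex {A B : Type*} [AddCommGroup A] [AddCommGroup B] (φ : A →+ B) {d : ℕ}
    (ω : Fin d → Bool) (s : (Fin d → A) × A) :
    φ (cubeVertex ω s) = cubeVertex ω (fun i => φ (s.1 i), φ s.2) := by
  simp only [cubeVertex_apply, map_sub, map_sum, apply_ite φ, map_zero]

/-- Conjugation is invisible on real values, and the first entry of `ω` records which of the two
factors of the outermost derivative is taken. -/
theorem foldr_mulDerivative_ofReal {A : Type*} [AddCommGroup A] (r : A → ℝ) {d : ℕ}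
    (h : Fin d → A) (n : A) :
    (List.ofFn h).foldr mulDerivative (fun x => (r x : ℂ)) n =
      ((∏ ω : Fin d → Bool, r (cubeVertex ω (h, n)) : ℝ) : ℂ) := by
  induction d generalizing n with
  | zero => simp [cubeVertex_apply]
  | succ d ih =>
    rw [List.ofFn_succ, List.foldr_cons, mulDerivative, ih, ih, Complex.conj_ofReal,
      ← Complex.ofReal_mul, ← (Fin.consEquiv fun _ : Fin (d + 1) => Bool).prod_comp,
      Fintype.prod_prod_type, Fintype.prod_bool, mul_comm]
    simp [cubeVertex_apply, Fin.consEquiv, Fin.sum_univ_succ, sub_sub]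

theorem gowersAverage_ofReal {A : Type*} [AddCommGroup A] [Fintype A] (r : A → ℝ) (d : ℕ) :
    gowersAverage d (fun x => (r x : ℂ)) =
      ((𝔼 s : (Fin d → A) × A, ∏ ω : Fin d → Bool, r (cubeVertex ω s) : ℝ) : ℂ) := by
  rw [gowersAverage, Complex.ofReal_expect, ← Finset.univ_product_univ, Finset.expect_product]
  simp only [foldr_mulDerivative_ofReal]

theorem sum_zsmul_cubeVertex {A : Type*} [AddCommGroup A] {d : ℕ} (a : (Fin d → Bool) → ℤ)
    (s : (Fin d → A) × A) : ∑ ω, a ω • cubeVertex ω s =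
      (∑ ω, a ω) • s.2 + ∑ i, (∑ ω, a ω * if ω i then -1 else 0) • s.1 i := by
  simp only [cubeVertex_apply, smul_sub, Finset.sum_sub_distrib, Finset.sum_smul, Finset.smul_sum]
  rw [sub_eq_add_neg, ← Finset.sum_neg_distrib, Finset.sum_comm (s := Finset.univ (α := Fin d))]
  congr 1
  refine Finset.sum_congr rfl fun ω _ => ?_
  rw [← Finset.sum_neg_distrib]
  refine Finset.sum_congr rfl fun i _ => ?_
  split_ifs <;> simp

/-- The limit object for cubes: free cubes in the first variable, and free points in the second. -/
abbrev CubeLimit (d : ℕ) : Type :=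
  ((Fin d → UnitAddCircle) × UnitAddCircle) × ((Fin d → Bool) → UnitAddCircle)

instance borelSpace_cubeLimit (d : ℕ) : BorelSpace (CubeLimit d) := Prod.borelSpace

instance measurableAdd_cubeLimit (d : ℕ) : MeasurableAdd (CubeLimit d) :=
  ContinuousAdd.measurableAdd

instance isAddHaarMeasure_volume_cubeLimit (d : ℕ) :
    (volume : Measure (CubeLimit d)).IsAddHaarMeasure :=
  have : (volume : Measure ((Fin d → UnitAddCircle) × UnitAddCircle)).IsAddHaarMeasure :=
    Measure.prod.instIsAddHaarMeasure volume volume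
  Measure.prod.instIsAddHaarMeasure volume volume

instance isProbabilityMeasure_volume_cubeLimit (d : ℕ) :
    IsProbabilityMeasure (volume : Measure (CubeLimit d)) :=
  inferInstanceAs (IsProbabilityMeasure (((volume : Measure (Fin d → UnitAddCircle)).prod
    volume).prod volume))

theorem measurePreserving_cubeLimit {d : ℕ} (ω : Fin d → Bool) :
    MeasurePreserving (fun w : CubeLimit d => (cubeVertex ω w.1, w.2 ω)) volume volume := by
  let f : CubeLimit d →+ UnitAddCircle × UnitAddCircle :=
    { toFun := fun w => (cubeVertex ω w.1, w.2 ω)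
      map_zero' := by simp
      map_add' := fun v w => by simp }
  refine AddMonoidHom.measurePreserving (f := f) ?_ ?_ (by simp)
  · refine Continuous.prodMk ?_ (by fun_prop)
    simp only [cubeVertex_apply]
    refine Continuous.sub (by fun_prop) (continuous_finsetSum _ fun i _ => ?_)
    split_ifs <;> fun_prop
  · rintro ⟨x, y⟩
    exact ⟨((0, x), fun _ => y), by simp [f, cubeVertex_apply]⟩

/-- The character of the limit object with frequencies `a` and `b`. -/
noncomputable def cubeCharacter {d : ℕ} (a b : (Fin d → Bool) → ℤ) :
    CubeLimit d →+ UnitAddCircle :=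
  AddMonoidHom.mk' (fun w => ∑ ω, (a ω • cubeVertex ω w.1 + b ω • w.2 ω)) fun v w => by
    rw [← Finset.sum_add_distrib]
    refine Finset.sum_congr rfl fun ω _ => ?_
    simp only [Prod.fst_add, Prod.snd_add, map_add, Pi.add_apply, smul_add]
    abel

theorem cubeCharacter_apply {d : ℕ} (a b : (Fin d → Bool) → ℤ) (w : CubeLimit d) :
    cubeCharacter a b w = ∑ ω, (a ω • cubeVertex ω w.1 + b ω • w.2 ω) := rfl

/-- The point of the limit object given by the cube `s` in `ℤ/Nℤ` and the `d`-th powers of its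
vertices. -/
noncomputable def cubeSamplePoint (d N : ℕ) [NeZero N] (s : (Fin d → ZMod N) × ZMod N) :
    CubeLimit d :=
  ((fun i => ZMod.toAddCircle (s.1 i), ZMod.toAddCircle s.2),
    fun ω => ZMod.toAddCircle (cubeVertex ω s ^ d))

/-- The powers have degree equal to the cube dimension, which is just enough to isolate one vertex
with as many directions as the degree. Hence no relation between the powers survives. -/
theorem tendsto_expect_cubeCharacter {j : ℕ} (hj : 1 ≤ j) (a b : (Fin (j + 1) → Bool) → ℤ) :
    Tendsto (fun N : ℕ+ => 𝔼 s, unitChar (cubeCharacter a b (cubeSamplePoint (j + 1) N s))) atTop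
      (𝓝 (∫ w, unitChar (cubeCharacter a b w))) := by
  have hzero : ∀ {w : CubeLimit (j + 1)}, cubeCharacter a b w ≠ 0 →
      ∫ w, unitChar (cubeCharacter a b w) = 0 := fun hw =>
    integral_unitChar_eq_zero _ (cubeCharacter a b) hw
  have hsample : ∀ (N : ℕ+) (s : (Fin (j + 1) → ZMod N) × ZMod N),
      cubeCharacter a b (cubeSamplePoint (j + 1) N s) =
        ∑ ω, (a ω • ZMod.toAddCircle (cubeVertex ω s) +
          b ω • ZMod.toAddCircle (cubeVertex ω s ^ (j + 1))) := by
    intro N s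
    simp only [cubeCharacter_apply, cubeSamplePoint, map_cubeVertex]
  by_cases hb : b = 0
  · have hval : ∀ w, cubeCharacter a b w =
        (∑ ω, a ω) • w.1.2 + ∑ i, (∑ ω, a ω * if ω i then -1 else 0) • w.1.1 i := by
      intro w
      rw [cubeCharacter_apply, ← sum_zsmul_cubeVertex]
      simp [hb]
    have hsample' : ∀ (N : ℕ+) (s : (Fin (j + 1) → ZMod N) × ZMod N),
        cubeCharacter a b (cubeSamplePoint (j + 1) N s) =
          ∑ ω, a ω • ZMod.toAddCircle (cubeVertex ω s) := by
      intro N s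
      rw [hsample]
      simp [hb]
    by_cases hA : ∑ ω, a ω = 0
    · by_cases hB : ∀ i, (∑ ω, a ω * if ω i then -1 else 0) = 0
      · have htriv : ∀ w, cubeCharacter a b w = 0 := by
          intro w
          rw [hval, hA]
          simp only [hB, zero_smul, Finset.sum_const_zero, add_zero]
        simp [htriv, unitChar_zero]
      · push Not at hB
        obtain ⟨i, hi⟩ := hB
        obtain ⟨t, ht⟩ := exists_zsmul_ne_zero hi
        rw [hzero (w := ((Pi.single i t, 0), 0)) (by
          rw [hval, hA]
          simpa [Pi.single_apply, smul_ite] using ht)]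
        simp only [hsample']
        refine tendsto_expect_linearPhase_zero (fun N : ℕ+ => (Fin (j + 1) → ZMod N) × ZMod N)
          (fun _ ω => cubeVertex ω) (fun _ => (Pi.single i 1, 0)) (fun ω => if ω i then -1 else 0)
          (fun N ω => ?_) a hi
        rw [cubeVertex_apply, Finset.sum_eq_single i (fun l _ hl => by simp [hl]) (by simp)]
        split_ifs <;> simp
    · obtain ⟨t, ht⟩ := exists_zsmul_ne_zero hA
      rw [hzero (w := ((0, t), 0)) (by rw [hval]; simpa using ht)]
      simp only [hsample']
      exact tendsto_expect_linearPhase_zero (fun N : ℕ+ => (Fin (j + 1) → ZMod N) × ZMod N)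
        (fun _ ω => cubeVertex ω) (fun _ => (0, 1)) (fun ω => 1)
        (fun N ω => by simp [cubeVertex_apply]) a (by simpa using hA)
  -- The direction for `l` is the edge `l` if `ω₀ l` holds, and the base point otherwise. The
  -- product of the forms is then nonzero only at vertices `ω ≥ ω₀`, and by maximality `ω₀` is the
  -- only one of these with `b ω ≠ 0`.
  · obtain ⟨ω₀, hω₀, hmax⟩ := (Set.toFinite {ω | b ω ≠ 0}).exists_maximal (Function.ne_iff.1 hb)
    obtain ⟨t, ht⟩ := exists_zsmul_ne_zero hω₀
    rw [hzero (w := (0, Pi.single ω₀ t)) (by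
      rw [cubeCharacter_apply]
      simpa [Pi.single_apply, smul_ite] using ht)]
    simp only [hsample]
    refine tendsto_expect_powerPhase_zero (fun N : ℕ+ => (Fin (j + 1) → ZMod N) × ZMod N)
      (fun _ ω => cubeVertex ω) hj (fun l N => if ω₀ l then (Pi.single l 1, 0) else (0, 1))
      (fun l ω => if ω₀ l then (if ω l then -1 else 0) else 1) (fun N l ω => ?_) a b ?_
    · by_cases h : ω₀ l
      · simp only [h, if_true]
        rw [cubeVertex_apply, Finset.sum_eq_single l (fun i _ hi => by simp [hi]) (by simp)]
        split_ifs <;> simp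
      · simp [h, cubeVertex_apply]
    · rw [Finset.sum_eq_single ω₀]
      · refine mul_ne_zero hω₀ (Finset.prod_ne_zero_iff.2 fun l _ => ?_)
        by_cases h : ω₀ l <;> simp [h]
      · intro ω _ hω
        by_cases hle : ω₀ ≤ ω
        · by_cases hbω : b ω = 0
          · rw [hbω, zero_mul]
          · exact absurd (le_antisymm (hmax hbω hle) hle) hω
        · obtain ⟨l, hl⟩ := not_forall.1 hle
          have hl' : ω₀ l = true ∧ ω l = false := by
            revert hl
            cases ω₀ l <;> cases ω l <;> simp
          rw [Finset.prod_eq_zero (Finset.mem_univ l) (by simp [hl'.1, hl'.2]), mul_zero]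
      · simp

/-- For fixed cube `z` the second coordinates are independent, so the inner integral is a product of
fibre integrals. The factor at `ω = 0`, whose vertex is the base point, vanishes for almost every
`z`. -/
theorem integral_cubeLimit_eq_zero {d : ℕ} {F : UnitAddCircle × UnitAddCircle → ℝ}
    (hF1 : ∀ p, |F p| ≤ 1) (hF : AEStronglyMeasurable F volume)
    (hF0 : ∀ᵐ x : UnitAddCircle, ∫ y : UnitAddCircle, F (x, y) = 0) :
    ∫ w : CubeLimit d, ∏ ω, F (cubeVertex ω w.1, w.2 ω) = 0 := by
  have hint : Integrable (fun w : CubeLimit d => ∏ ω, F (cubeVertex ω w.1, w.2 ω)) volume :=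
    integrable_prod_comp (Q := fun (w : CubeLimit d) ω => (cubeVertex ω w.1, w.2 ω))
      measurePreserving_cubeLimit hF1 hF
  rw [Measure.volume_eq_prod] at hint ⊢
  rw [integral_prod _ hint]
  refine integral_eq_zero_of_ae ?_
  have hsnd : Measure.QuasiMeasurePreserving
      (fun z : (Fin d → UnitAddCircle) × UnitAddCircle => z.2) volume volume :=
    Measure.quasiMeasurePreserving_snd
  filter_upwards [hsnd.ae hF0] with z hz
  rw [integral_fintype_prod_volume_eq_prod
    (fun (ω : Fin d → Bool) (y : UnitAddCircle) => F (cubeVertex ω z, y))]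
  refine Finset.prod_eq_zero (Finset.mem_univ fun _ => false) ?_
  simpa [cubeVertex_apply] using hz

theorem tendsto_gowersNorm_torusSample {j : ℕ} (hj : 1 ≤ j)
    {F : UnitAddCircle × UnitAddCircle → ℝ} (hF1 : ∀ p, |F p| ≤ 1) (hF : HasContinuousSqueeze F)
    (hF0 : ∀ᵐ x : UnitAddCircle, ∫ y : UnitAddCircle, F (x, y) = 0) :
    Tendsto (fun N : ℕ+ => gowersNorm (j + 1)
      (fun n : ZMod (N : ℕ) => ((torusSample (j + 3) F (N : ℕ) n : ℝ) : ℂ))) atTop (𝓝 0) := by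
  have h := tendsto_expect_prod_of_characters
    (fun N : ℕ+ => (Fin (j + 1) → ZMod N) × ZMod N)
    (fun N s ω => (cubeVertex ω (cubeSamplePoint (j + 1) N s).1, (cubeSamplePoint (j + 1) N s).2 ω))
    (Q := fun (w : CubeLimit (j + 1)) ω => (cubeVertex ω w.1, w.2 ω))
    measurePreserving_cubeLimit (tendsto_expect_cubeCharacter hj) hF1 hF
  rw [integral_cubeLimit_eq_zero hF1 hF.aestronglyMeasurable hF0] at h
  have h2 := (h.norm.rpow_const (p := ((2 : ℝ) ^ (j + 1))⁻¹) (Or.inr (by positivity)))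
  rw [norm_zero, Real.zero_rpow (by positivity)] at h2
  refine h2.congr fun N => ?_
  rw [gowersNorm, gowersAverage_ofReal, Complex.norm_real]
  congr 2
  refine Finset.expect_congr rfl fun s _ => Finset.prod_congr rfl fun ω _ => ?_
  simp only [cubeSamplePoint, torusSample, map_cubeVertex]
  rfl

end Gowers

/-! ### Assembly of the two limits -/

theorem mainTheorem10 (k : ℕ) (hk : 4 ≤ k) (F : UnitAddCircle × UnitAddCircle → ℝ)
    (hF01 : ∀ p, F p ∈ Set.Icc (0 : ℝ) 1) (hF : TorusRiemannIntegrable F)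
    (α : ℝ) (hα : HasConstantFirstMarginal F α) :
    Tendsto (fun N : ℕ+ =>
        gowersNorm (k - 2) (fun n : ZMod (N : ℕ) => ((torusSample k F (N : ℕ) n - α : ℝ) : ℂ)))
      atTop (𝓝 0) ∧
    Integrable (apBinomialProduct k F) (apBinomialMeasure k) ∧
    Tendsto (fun N : ℕ+ => apDensity k (torusSample k F (N : ℕ))) atTop
      (𝓝 (torusApDensity k F)) := by
  obtain ⟨j, rfl⟩ : ∃ j, k = j + 3 := ⟨k - 3, by omega⟩
  have hj : 1 ≤ j := by omega
  -- A single fibre with integral `α` already forces `α ∈ [0,1]`, hence `|F - α| ≤ 1`.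
  obtain ⟨x, hx⟩ := hα.exists
  have hα01 : α ∈ Set.Icc (0 : ℝ) 1 := by
    rw [← hx]
    refine ⟨integral_nonneg fun y => (hF01 _).1, ?_⟩
    have h := norm_integral_le_of_norm_le_const (μ := (volume : Measure UnitAddCircle))
      (f := fun y => F (x, y)) (C := 1) (ae_of_all _ fun y => by
        rw [Real.norm_of_nonneg (hF01 _).1]
        exact (hF01 _).2)
    exact (le_abs_self _).trans (h.trans (by simp))
  have hFabs : ∀ p, |F p| ≤ 1 := fun p => abs_le.2 ⟨by linarith [(hF01 p).1], (hF01 p).2⟩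
  have hsq : HasContinuousSqueeze F := by
    simpa using hF.hasContinuousSqueeze_sub_const hF01 (α := 0) ⟨le_rfl, zero_le_one⟩
  have hmarginal : ∀ᵐ x : UnitAddCircle, ∫ y : UnitAddCircle, (F (x, y) - α) = 0 := by
    have hint : Integrable F ((volume : Measure UnitAddCircle).prod volume) :=
      Integrable.of_bound hsq.aestronglyMeasurable 1 (ae_of_all _ hFabs)
    filter_upwards [hα, hint.prod_right_ae] with x hx hxi
    rw [integral_sub hxi (integrable_const α), hx]
    simp
  refine ⟨?_, integrable_apBinomialProduct j hFabs hsq, tendsto_apDensity_torusSample hj hFabs hsq⟩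
  exact tendsto_gowersNorm_torusSample hj (F := fun p => F p - α)
    (fun p => abs_le.2 ⟨by linarith [(hF01 p).1, hα01.2], by linarith [(hF01 p).2, hα01.1]⟩)
    (hF.hasContinuousSqueeze_sub_const hF01 hα01) hmarginal
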